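/- Let $K$ be a field of characteristic $p>0$, and let $\mathbb{N}=\{0,1,2,\dots\}$. Let $a\in K^{\mathbb{N}}$ be a $K$-recurrence sequence of order $d$; that is, $d\ge 0$ is the smallest integer for which there exist $\gamma_0,\dots,\gamma_{d-1}\in K$ with $$a(n+d)=\gamma_{d-1}a(n+d-1)+\cdots+\gamma_0a(n)\quad\text{for all } n\in\mathbb{N}.$$ Then the zero set $\mathcal{Z}(a)=\{n\in\mathbb{N}\mid a(n)=0\}$ is $p$-normal of order $\le d-2$. That is, there are finitely many infinite arithmetic progressions $m+n\mathbb{N}$ (with $m,n\in\mathbb{N}$, $n\geq 1$) and finitely many elementary $p$-nested sets of order $\le d-2$ such that the symmetric difference of $\mathcal{Z}(a)$ and the union of all these sets is finite. Here an elementary $p$-nested set of order $r$ (where $r\ge 1$) is a set of the form $$S_q(c_0;c_1,\dots,c_r)=\{c_0+c_1q^{k_1}+\cdots+c_rq^{k_r}\mid k_1,\dots,k_r\in\mathbb{N}\}\cap\mathbb{N},$$ where $q=p^e$ for some integer $e\ge 1$, and $c_0,c_1,\dots,c_r\in\mathbb{Q}$ satisfy $(q-1)c_i\in\mathbb{Z}$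 for $0\le i\le r$, $c_0+c_1+\cdots+c_r\in\mathbb{Z}$, $c_i\ne 0$ for $1\le i\le r$, and $c_i>0$ for at least one $i$ with $1\le i\le r$. (In particular, if $d\le 2$ there are no elementary $p$-nested sets of order $\le d-2$, and the assertion is that $\mathcal{Z}(a)$ is, up to a finite set, a finite union of infinite arithmetic progressions.) -/

import Mathlib

/-- `a` is a `K`-recurrence sequence of order `d`: the number `d` is the smallest length of a
linear recurrence relation `a (n + d) = γ_{d-1} a (n + d - 1) + ⋯ + γ_0 a n` (for all `n`, with
coefficients in `K`) that is satisfied by `a`. -/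
def IsRecurrenceSeqOfOrder (K : Type*) [Field K] (a : ℕ → K) (d : ℕ) : Prop :=
  IsLeast {m : ℕ | ∃ E : LinearRecurrence K, E.order = m ∧ E.IsSolution a} d

/-- The set of zeroes of a sequence. -/
def zeroSet {K : Type*} [Field K] (a : ℕ → K) : Set ℕ :=
  {n | a n = 0}

/-- An infinite arithmetic progression `m + n ℕ` with `m` in `ℕ` and `n` a positive integer. -/
def IsInfiniteAP (S : Set ℕ) : Prop :=
  ∃ m n : ℕ, 0 < n ∧ S = {x | ∃ k : ℕ, x = m + n * k}

/-- The set `S_q(c₀; c₁, …, c_r)` of all natural numbers of the form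
`c₀ + c₁ q ^ k₁ + ⋯ + c_r q ^ k_r` with `k₁, …, k_r` in `ℕ`. -/
def nestedSet (q : ℕ) {r : ℕ} (c₀ : ℚ) (c : Fin r → ℚ) : Set ℕ :=
  {n | ∃ k : Fin r → ℕ, (n : ℚ) = c₀ + ∑ i, c i * (q : ℚ) ^ k i}

/-- Elementary `p`-nested sets of order `r`: the sets `S_q(c₀; c₁, …, c_r)` with `r ≥ 1`,
`q = p ^ e` for a positive integer `e`, all `(q - 1) c_i` integers, `c₀ + c₁ + ⋯ + c_r` an
integer, `c₁, …, c_r` nonzero, and at least one of `c₁, …, c_r` positive. -/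
def IsElementaryPNested (p r : ℕ) (S : Set ℕ) : Prop :=
  1 ≤ r ∧ ∃ (q e : ℕ) (c₀ : ℚ) (c : Fin r → ℚ),
    1 ≤ e ∧ q = p ^ e ∧
    (∃ z : ℤ, ((q : ℚ) - 1) * c₀ = z) ∧
    (∀ i, ∃ z : ℤ, ((q : ℚ) - 1) * c i = z) ∧
    (∃ z : ℤ, c₀ + ∑ i, c i = z) ∧
    (∀ i, c i ≠ 0) ∧
    (∃ i, 0 < c i) ∧
    S = nestedSet q c₀ c

/-- `p`-nested sets of order `≤ m`: unions of a finite set and finitely many elementary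
`p`-nested sets of order `≤ m`. The bound is an integer; for `m ≤ 0` there are no
elementary `p`-nested sets of order `≤ m`, and these are exactly the finite sets. -/
def IsPNestedOfOrderLE (p : ℕ) (m : ℤ) (S : Set ℕ) : Prop :=
  ∃ (F : Set ℕ) (𝒯 : Set (Set ℕ)), F.Finite ∧ 𝒯.Finite ∧
    (∀ T ∈ 𝒯, ∃ r : ℕ, (r : ℤ) ≤ m ∧ IsElementaryPNested p r T) ∧
    S = F ∪ ⋃₀ 𝒯

/-- `p`-normal sets of order `≤ m`: the sets that are equal, up to a finite set, to the union of
a `p`-nested set of order `≤ m` and finitely many infinite arithmetic progressions. -/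
def IsPNormalOfOrderLE (p : ℕ) (m : ℤ) (S : Set ℕ) : Prop :=
  ∃ (N : Set ℕ) (𝒜 : Set (Set ℕ)), IsPNestedOfOrderLE p m N ∧ 𝒜.Finite ∧
    (∀ A ∈ 𝒜, IsInfiniteAP A) ∧
    (symmDiff S (N ∪ ⋃₀ 𝒜)).Finite

/-!
The zero set of an exponential sum `∑ α i * l i ^ n` is the set of exponents `n` for which the
vector `l ^ n` lies in a hyperplane of `K ^ ι`. More generally, for a subspace `Y`, the relation
`l ^ (n + p ^ e * m) ∈ Y` is equivalent to `l ^ m ∈ Y'`, where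
`Y' = {y | l ^ n * y ^ (p ^ e) ∈ Y}`. Thus the base `p` digits of the exponent act on subspaces,
and three facts determine the set `expSet l Y` of exponents with `l ^ n ∈ Y`.

* Only finitely many subspaces arise from a given hyperplane (`exists_finite_states`). The field
  may be taken to be finitely generated; then it is finite over `K ^ p`, and the `p⁻¹`-linear
  coordinate maps that describe `Y'` divide degrees by `p`, up to a bounded error.
* The dimension does not increase along a step (`finrank_frobStep_le`).
* If no quotient of two of the `l i` is a root of unity, then a step that keeps the dimension
  determines its exponent (`frobStep_exponent_unique`), because a proper subspace that contains
  a power of `l` is not stable under a nontrivial power of `l`. Hence a path along which the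
  dimension is constant cannot leave a cycle and enter another one (`finrank_lt_of_ne_loop`).

With `q` a power of `p` whose exponent is divisible by the lengths of all cycles, induction on
`dim Y` shows that `expSet l Y` is a finite union of sets of values of
`c₀ + c₁ q ^ k₁ + c₂ q ^ (k₁ + k₂) + ⋯` with at most `dim Y - 1` powers of `q`
(`isChainUnion_expSet`): each cycle contributes one power, and a line contains at most one power
of `l`. For a hyperplane this gives the bound `d - 2`.

In these chains the exponents of `q` increase, but they can be made independent: the vectors
`ν ^ (q ^ k)` with `k ≥ k₀` span the same space over a perfect field for every `k₀`, so that a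
linear relation that holds for all large `k` holds for all `k` (`sum_mul_pow_eq_zero_of_le`).
This yields elementary `p`-nested sets.

Finally, a recurrence sequence of order `d` is an exponential sum with at most `d` terms along the
residue classes modulo a power of `p` (`exists_exponentialSum_of_isSolution`), and on finer
residue classes the bases whose quotients are roots of unity can be merged
(`isAlmostUnion_exponentialSum`).
-/

/-! ### Subspaces pulled back along twisted powers of Frobenius -/

section FrobStep

variable {K ι : Type*} [Field K] (p : ℕ) [Fact p.Prime] [CharP K p]

/-- The subspace `{y | l ^ n * y ^ (p ^ e) ∈ Y}` of `K ^ ι` (products and powers are taken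
coordinatewise): the preimage of `Y` under the `e`-th power of Frobenius followed by the diagonal
map `l ^ n`. -/
def frobStep (l : ι → K) (Y : Submodule K (ι → K)) (e n : ℕ) : Submodule K (ι → K) where
  carrier := {y | l ^ n * y ^ p ^ e ∈ Y}
  zero_mem' := by
    have : (0 : ι → K) ^ p ^ e = 0 := zero_pow (pow_ne_zero _ (Fact.out : p.Prime).ne_zero)
    simp [this]
  add_mem' := by
    intro x y hx hy
    have : (x + y) ^ p ^ e = x ^ p ^ e + y ^ p ^ e := by
      ext i; simp [add_pow_char_pow]
    simp only [Set.mem_ofPred_eq, this, mul_add] at *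
    exact Y.add_mem hx hy
  smul_mem' := by
    intro c x hx
    simp only [Set.mem_ofPred_eq, smul_pow, mul_smul_comm] at *
    exact Y.smul_mem _ hx

/-- The exponents `n` for which the vector `l ^ n` lies in `Y`. -/
def expSet (l : ι → K) (Y : Submodule K (ι → K)) : Set ℕ := {n | l ^ n ∈ Y}

variable {p} {l : ι → K} {Y : Submodule K (ι → K)}

lemma mem_frobStep {e n : ℕ} {y : ι → K} :
    y ∈ frobStep p l Y e n ↔ l ^ n * y ^ p ^ e ∈ Y := Iff.rfl

lemma mem_expSet {n : ℕ} : n ∈ expSet l Y ↔ l ^ n ∈ Y := Iff.rfl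

lemma frobStep_frobStep (e n e' n' : ℕ) :
    frobStep p l (frobStep p l Y e n) e' n' = frobStep p l Y (e + e') (n + p ^ e * n') := by
  ext y
  have : l ^ n * (l ^ n' * y ^ p ^ e') ^ p ^ e
      = l ^ (n + p ^ e * n') * y ^ p ^ (e + e') := by
    rw [mul_pow, ← pow_mul, ← pow_mul, ← mul_assoc, ← pow_add, ← pow_add, mul_comm n',
      add_comm e' e]
  simp only [mem_frobStep, this]

lemma frobStep_zero_zero : frobStep p l Y 0 0 = Y := by
  ext y; simp [mem_frobStep]

/-- Reading off the last `e` digits of an exponent in base `p`. -/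
lemma add_mul_mem_expSet {e n m : ℕ} :
    n + p ^ e * m ∈ expSet l Y ↔ m ∈ expSet l (frobStep p l Y e n) := by
  rw [mem_expSet, mem_expSet, mem_frobStep, ← pow_mul, ← pow_add, mul_comm m]

lemma mem_expSet_iff_mod_div {e x : ℕ} :
    x ∈ expSet l Y ↔ x / p ^ e ∈ expSet l (frobStep p l Y e (x % p ^ e)) := by
  rw [← add_mul_mem_expSet, Nat.mod_add_div]

/-- Linear independence survives a field homomorphism and a diagonal scaling: the dual system
can be transported as well. -/
lemma LinearIndependent.smul_map_ringHom [Fintype ι] {κ : Type*} [Fintype κ] {v : κ → ι → K}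
    (hv : LinearIndependent K v) (σ : K →+* K) {u : ι → K} (hu : ∀ i, u i ≠ 0) :
    LinearIndependent K (fun j i => u i * σ (v j i)) := by
  classical
  obtain ⟨φ, hφ⟩ := LinearMap.exists_leftInverse_of_injective (Fintype.linearCombination K v)
    (LinearMap.ker_eq_bot.mpr (hv.fintypeLinearCombination_injective))
  have hφv : ∀ i j, φ (v i) j = if i = j then 1 else 0 := by
    intro i j
    have := LinearMap.congr_fun hφ (Pi.single i 1)
    simp only [LinearMap.coe_comp, Function.comp_apply, LinearMap.id_coe, id_eq,
      Fintype.linearCombination_apply_single, one_smul] at this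
    rw [this, Pi.single_apply]
    simp [eq_comm]
  have hsum : ∀ i j, ∑ x, v i x * φ (Pi.single x 1) j = if i = j then 1 else 0 := by
    intro i j
    have h := congrFun (congrArg φ (pi_eq_sum_univ' (v i))) j
    rw [← hφv, h]
    simp [Finset.sum_apply]
  rw [Fintype.linearIndependent_iff]
  intro g hg j
  have h1 : ∑ x, (∑ i, g i • (fun i' => u i' * σ (v i i'))) x
      * ((u x)⁻¹ * σ (φ (Pi.single x 1) j)) = 0 := by
    rw [hg]; simp
  simp only [Finset.sum_apply, Pi.smul_apply, smul_eq_mul, Finset.sum_mul] at h1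
  rw [Finset.sum_comm] at h1
  have h2 : ∀ i, ∑ x, g i * (u x * σ (v i x)) * ((u x)⁻¹ * σ (φ (Pi.single x 1) j))
      = g i * if i = j then 1 else 0 := by
    intro i
    have h3 : (if i = j then (1 : K) else 0) = σ (if i = j then 1 else 0) := by
      split_ifs <;> simp
    rw [h3, ← hsum, map_sum, Finset.mul_sum]
    refine Finset.sum_congr rfl fun x _ => ?_
    rw [map_mul]
    field_simp [hu x]
  simpa [h2] using h1

lemma exists_frobStep_family [Fintype ι] (hl : ∀ i, l i ≠ 0) (e n : ℕ) :
    ∃ w : Fin (Module.finrank K (frobStep p l Y e n)) → ι → K,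
      LinearIndependent K w ∧
        ∀ j, ∃ y ∈ frobStep p l Y e n, w j = l ^ n * y ^ p ^ e := by
  let b := Module.finBasis K (frobStep p l Y e n)
  have hb : LinearIndependent K (fun j => (b j : ι → K)) :=
    b.linearIndependent.map' (Submodule.subtype _) (Submodule.ker_subtype _)
  refine ⟨fun j => l ^ n * (b j : ι → K) ^ p ^ e, ?_, fun j => ⟨b j, (b j).2, rfl⟩⟩
  have := hb.smul_map_ringHom (iterateFrobenius K p e) (u := l ^ n)
    (fun i => pow_ne_zero _ (hl i))
  exact this

lemma span_le_of_frobStep {κ : Type*} {e n : ℕ} {w : κ → ι → K}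
    (hw : ∀ j, ∃ y ∈ frobStep p l Y e n, w j = l ^ n * y ^ p ^ e) :
    Submodule.span K (Set.range w) ≤ Y := by
  rw [Submodule.span_le]
  rintro _ ⟨j, rfl⟩
  obtain ⟨y, hy, h⟩ := hw j
  rw [h]
  exact hy

lemma finrank_frobStep_le [Fintype ι] (hl : ∀ i, l i ≠ 0) (e n : ℕ) :
    Module.finrank K (frobStep p l Y e n) ≤ Module.finrank K Y := by
  obtain ⟨w, hw, hy⟩ := exists_frobStep_family (p := p) (Y := Y) hl e n
  have := Submodule.finrank_mono (span_le_of_frobStep hy)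
  rwa [finrank_span_eq_card hw, Fintype.card_fin] at this

lemma span_eq_of_finrank_frobStep [Fintype ι] (hl : ∀ i, l i ≠ 0) {e n : ℕ}
    (h : Module.finrank K Y ≤ Module.finrank K (frobStep p l Y e n)) :
    Y ≤ Submodule.span K {w | ∃ y ∈ frobStep p l Y e n, w = l ^ n * y ^ p ^ e} := by
  obtain ⟨w, hw, hy⟩ := exists_frobStep_family (p := p) (Y := Y) hl e n
  have := Submodule.eq_of_le_of_finrank_le (span_le_of_frobStep hy)
    (by rwa [finrank_span_eq_card hw, Fintype.card_fin])
  refine this.ge.trans (Submodule.span_mono ?_)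
  rintro _ ⟨j, rfl⟩
  exact hy j

/-- A subspace that contains a vector without zero coordinates and is stable under a diagonal
map with distinct entries is the whole space. -/
lemma eq_top_of_diagonal_stable [Fintype ι] {u x : ι → K} (hu : Function.Injective u)
    (hx : ∀ i, x i ≠ 0) (hxY : x ∈ Y) (hY : ∀ y ∈ Y, u * y ∈ Y) : Y = ⊤ := by
  classical
  have hpoly : ∀ P : Polynomial K, (fun i => P.eval (u i) * x i) ∈ Y := by
    intro P
    induction P using Polynomial.induction_on' with
    | add P Q hP hQ =>
      convert Y.add_mem hP hQ using 1
      ext i; simp [add_mul]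
    | monomial n a =>
      have hn : u ^ n * x ∈ Y := by
        induction n with
        | zero => simpa using hxY
        | succ n ih =>
          have := hY _ ih
          rwa [← mul_assoc, ← pow_succ'] at this
      convert Y.smul_mem a hn using 1
      ext i; simp [mul_assoc]
  have hsingle : ∀ i, (Pi.single i 1 : ι → K) ∈ Y := by
    intro i
    convert Y.smul_mem (x i)⁻¹ (hpoly (Lagrange.basis Finset.univ u i)) using 1
    ext j
    by_cases hij : i = j
    · subst hij
      simp [Lagrange.eval_basis_self hu.injOn (Finset.mem_univ i), hx i]
    · simp [Lagrange.eval_basis_of_ne hij (Finset.mem_univ j), Ne.symm hij]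
  rw [eq_top_iff]
  intro y _
  rw [pi_eq_sum_univ' y]
  exact Y.sum_mem fun i _ => Y.smul_mem _ (hsingle i)

/-- The nondegenerate case: no nontrivial power of `l` stabilizes a proper subspace that contains
some power of `l`. -/
lemma eq_zero_of_pow_mul_mem [Fintype ι] (hl : ∀ i, l i ≠ 0)
    (hnd : ∀ i j n, 0 < n → l i ^ n = l j ^ n → i = j) (hY : Y ≠ ⊤)
    (hZ : (expSet l Y).Nonempty) {k : ℕ} (hk : ∀ y ∈ Y, l ^ k * y ∈ Y) : k = 0 := by
  obtain ⟨n, hn⟩ := hZ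
  by_contra h0
  exact hY (eq_top_of_diagonal_stable (u := l ^ k)
    (fun i j hij => hnd i j k (Nat.pos_of_ne_zero h0) hij) (fun i => pow_ne_zero n (hl i)) hn hk)

/-- Rigidity: a step that keeps the dimension determines its exponent. -/
lemma frobStep_exponent_unique [Fintype ι] (hl : ∀ i, l i ≠ 0)
    (hnd : ∀ i j n, 0 < n → l i ^ n = l j ^ n → i = j) (hY : Y ≠ ⊤)
    (hZ : (expSet l Y).Nonempty) {e m n : ℕ} (h : frobStep p l Y e m = frobStep p l Y e n)
    (hr : Module.finrank K Y ≤ Module.finrank K (frobStep p l Y e m)) : m = n := by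
  wlog hmn : m ≤ n generalizing m n
  · exact (this h.symm (h ▸ hr) (le_of_not_ge hmn)).symm
  obtain ⟨k, rfl⟩ := Nat.exists_eq_add_of_le hmn
  have : k = 0 := by
    refine eq_zero_of_pow_mul_mem hl hnd hY hZ fun y hy => ?_
    have hy' := span_eq_of_finrank_frobStep hl hr hy
    induction hy' using Submodule.span_induction with
    | mem w hw =>
      obtain ⟨z, hz, rfl⟩ := hw
      rw [h, mem_frobStep] at hz
      rwa [← mul_assoc, ← pow_add, add_comm k]
    | zero => simp
    | add a b ha hb iha ihb =>
      rw [mul_add]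
      have hle := Submodule.span_le.mpr (show {w | ∃ y ∈ frobStep p l Y e m,
        w = l ^ m * y ^ p ^ e} ⊆ (Y : Set (ι → K)) by rintro _ ⟨z, hz, rfl⟩; exact hz)
      exact Y.add_mem (iha (hle ha)) (ihb (hle hb))
    | smul c a ha iha =>
      have hle := Submodule.span_le.mpr (show {w | ∃ y ∈ frobStep p l Y e m,
        w = l ^ m * y ^ p ^ e} ⊆ (Y : Set (ι → K)) by rintro _ ⟨z, hz, rfl⟩; exact hz)
      rw [mul_smul_comm]
      exact Y.smul_mem _ (iha (hle ha))
  omega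

/-- A proper subspace of dimension at most one contains at most one power of `l`. -/
lemma subsingleton_expSet [Fintype ι] (hl : ∀ i, l i ≠ 0)
    (hnd : ∀ i j n, 0 < n → l i ^ n = l j ^ n → i = j) (hY : Y ≠ ⊤)
    (hr : Module.finrank K Y ≤ 1) : (expSet l Y).Subsingleton := by
  intro m hm n hn
  wlog hmn : m ≤ n generalizing m n
  · exact (this hn hm (le_of_not_ge hmn)).symm
  obtain ⟨k, rfl⟩ := Nat.exists_eq_add_of_le hmn
  have : k = 0 := by
    refine eq_zero_of_pow_mul_mem hl hnd hY ⟨m, hm⟩ fun y hy => ?_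
    have hne : l ^ m ≠ 0 := by
      intro h0
      refine hY ?_
      have hι : IsEmpty ι := ⟨fun i => pow_ne_zero m (hl i) (congrFun h0 i)⟩
      exact Subsingleton.elim _ _
    have hspan : Submodule.span K {l ^ m} = Y := by
      refine Submodule.eq_of_le_of_finrank_le ?_ ?_
      · simpa using mem_expSet.mp hm
      · rwa [finrank_span_singleton hne]
    rw [← hspan, Submodule.mem_span_singleton] at hy
    obtain ⟨c, rfl⟩ := hy
    rw [mul_smul_comm, ← pow_add, add_comm k]
    exact Y.smul_mem c hn
  omega

end FrobStep

/-! ### Finitely many states over a finitely generated field -/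

section Finiteness

open IntermediateField in
/-- A finitely generated field `K` of characteristic `p` is finite over `K ^ p`. Dually, there are
finitely many `p⁻¹`-linear maps `K → K` without a common nontrivial zero. -/
lemma exists_frobeniusInverse_linear_maps {K τ : Type*} [Field K] (p : ℕ) [Fact p.Prime]
    [CharP K p] [Finite τ] {t : τ → K} (ht : Subfield.closure (Set.range t) = ⊤) :
    ∃ (k : ℕ) (C : Fin k → K →+ K), (∀ j a x, C j (a ^ p * x) = a * C j x) ∧
      ∀ x, (∀ j, C j x = 0) → x = 0 := by
  let F : Subfield K := (frobenius K p).fieldRange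
  have hp : 0 < p := (Fact.out : p.Prime).pos
  have hint : ∀ x ∈ Set.range t, IsIntegral F x := by
    intro x _
    refine IsIntegral.of_pow hp ?_
    exact isIntegral_algebraMap (x := (⟨x ^ p, ⟨x, rfl⟩⟩ : F))
  have hfin : FiniteDimensional F (adjoin F (Set.range t)) :=
    finiteDimensional_adjoin hint
  have htop : adjoin F (Set.range t) = ⊤ := by
    rw [eq_top_iff]
    intro x _
    have hx : x ∈ Subfield.closure (Set.range t) := ht ▸ Subfield.mem_top x
    exact (Subfield.closure_le (t := (adjoin F (Set.range t)).toSubfield)).mpr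
      (subset_adjoin F (Set.range t)) hx
  rw [htop] at hfin
  have : FiniteDimensional F K := topEquiv.toLinearEquiv.finiteDimensional
  let b := Module.finBasis F K
  have hroot : ∀ y : F, ∃ x : K, x ^ p = y := fun y => y.2
  choose root hroot using hroot
  have hinj : ∀ x y : K, x ^ p = y ^ p → x = y := fun x y h => frobenius_inj K p h
  refine ⟨_, fun j => ⟨⟨fun x => root (b.repr x j), ?_⟩, ?_⟩, ?_, ?_⟩
  · apply hinj
    rw [hroot]
    simp [hp.ne']
  · intro x y
    apply hinj
    simp only [add_pow_char, hroot, map_add, Finsupp.add_apply, Subfield.coe_add]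
  · intro j a x
    apply hinj
    have : a ^ p * x = (⟨a ^ p, ⟨a, rfl⟩⟩ : F) • x := rfl
    simp only [AddMonoidHom.coe_mk, ZeroHom.coe_mk, mul_pow, hroot]
    rw [this]
    simp
  · intro x hx
    have : b.repr x = 0 := by
      ext j
      have := hx j
      simp only [AddMonoidHom.coe_mk, ZeroHom.coe_mk] at this
      rw [← hroot, this]
      simp [hp.ne']
    simpa using this

variable {K τ : Type*} [Field K] [Fintype τ] (p : ℕ) [Fact p.Prime] [Algebra (ZMod p) K]

/-- The polynomial expressions of degree at most `D` in the elements `t i`, with coefficients in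
the prime field. -/
def polySpan (t : τ → K) (D : ℕ) : Submodule (ZMod p) K :=
  Submodule.span (ZMod p) {x | ∃ m : τ → ℕ, ∑ i, m i ≤ D ∧ x = ∏ i, t i ^ m i}

variable {p} {t : τ → K}

lemma polySpan_mono {D E : ℕ} (h : D ≤ E) : polySpan p t D ≤ polySpan p t E :=
  Submodule.span_mono (by rintro _ ⟨m, hm, rfl⟩; exact ⟨m, hm.trans h, rfl⟩)

lemma mul_mem_polySpan {D E : ℕ} {x y : K} (hx : x ∈ polySpan p t D) (hy : y ∈ polySpan p t E) :
    x * y ∈ polySpan p t (D + E) := by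
  have := Submodule.mul_mem_mul hx hy
  rw [polySpan, polySpan, Submodule.span_mul_span] at this
  refine Submodule.span_mono ?_ this
  rintro _ ⟨_, ⟨m, hm, rfl⟩, _, ⟨n, hn, rfl⟩, rfl⟩
  refine ⟨m + n, ?_, ?_⟩
  · simp only [Pi.add_apply, Finset.sum_add_distrib]
    omega
  · simp [pow_add, Finset.prod_mul_distrib]

lemma one_mem_polySpan {D : ℕ} : (1 : K) ∈ polySpan p t D :=
  Submodule.subset_span ⟨0, by simp, by simp⟩

lemma mem_polySpan_one (i : τ) : t i ∈ polySpan p t 1 := by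
  classical
  refine Submodule.subset_span ⟨Pi.single i 1, by simp, ?_⟩
  rw [Finset.prod_eq_single i]
  · simp
  · intro j _ hj
    simp [hj]
  · simp

lemma pow_mem_polySpan {D : ℕ} {x : K} (hx : x ∈ polySpan p t D) (n : ℕ) :
    x ^ n ∈ polySpan p t (n * D) := by
  induction n with
  | zero => simpa using one_mem_polySpan
  | succ n ih =>
    rw [pow_succ, Nat.succ_mul]
    exact mul_mem_polySpan ih hx

lemma finite_polySpan (D : ℕ) : (polySpan p t D : Set K).Finite := by
  have hfin : {x : K | ∃ m : τ → ℕ, ∑ i, m i ≤ D ∧ x = ∏ i, t i ^ m i}.Finite := by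
    have h : (Set.univ.pi fun _ : τ => Set.Iic D).Finite := Set.Finite.pi fun _ => Set.finite_Iic D
    refine (h.image fun m => ∏ i, t i ^ m i).subset ?_
    rintro _ ⟨m, hm, rfl⟩
    refine ⟨m, ?_, rfl⟩
    intro i _
    exact (Finset.single_le_sum (fun _ _ => Nat.zero_le _) (Finset.mem_univ i)).trans hm
  have : Module.Finite (ZMod p) (polySpan p t D) := Module.Finite.span_of_finite _ hfin
  exact Module.finite_of_finite (ZMod p)

/-- A common denominator for finitely many elements. -/
lemma exists_common_denominator (ht : Subfield.closure (Set.range t) = ⊤) (B : Finset K) :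
    ∃ (δ : ℕ) (g : K), g ≠ 0 ∧ g ∈ polySpan p t δ ∧ ∀ b ∈ B, g * b ∈ polySpan p t δ := by
  classical
  have hring : ∀ x ∈ Subring.closure (Set.range t), ∃ D, x ∈ polySpan p t D := by
    intro x hx
    induction hx using Subring.closure_induction with
    | mem x hx =>
      obtain ⟨i, rfl⟩ := hx
      exact ⟨1, mem_polySpan_one i⟩
    | zero => exact ⟨0, zero_mem _⟩
    | one => exact ⟨0, one_mem_polySpan⟩
    | add x y _ _ hx hy =>
      obtain ⟨D, hD⟩ := hx
      obtain ⟨E, hE⟩ := hy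
      exact ⟨D + E, add_mem (polySpan_mono (by omega) hD) (polySpan_mono (by omega) hE)⟩
    | neg x _ hx =>
      obtain ⟨D, hD⟩ := hx
      exact ⟨D, neg_mem hD⟩
    | mul x y _ _ hx hy =>
      obtain ⟨D, hD⟩ := hx
      obtain ⟨E, hE⟩ := hy
      exact ⟨D + E, mul_mem_polySpan hD hE⟩
  induction B using Finset.induction_on with
  | empty => exact ⟨0, 1, one_ne_zero, one_mem_polySpan, by simp⟩
  | insert b B _ ih =>
    obtain ⟨δ, g, hg, hgδ, hB⟩ := ih
    have hb : b ∈ Subfield.closure (Set.range t) := ht ▸ Subfield.mem_top b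
    obtain ⟨y, hy, z, hz, rfl⟩ := Subfield.mem_closure_iff.mp hb
    obtain ⟨D, hD⟩ := hring y hy
    obtain ⟨E, hE⟩ := hring z hz
    by_cases hz0 : z = 0
    · refine ⟨δ, g, hg, hgδ, ?_⟩
      simpa [hz0] using hB
    · refine ⟨δ + D + E, g * z, mul_ne_zero hg hz0,
        polySpan_mono (by omega) (mul_mem_polySpan hgδ hE), ?_⟩
      intro c hc
      rcases Finset.mem_insert.mp hc with rfl | hc
      · have : g * z * (y / z) = g * y := by field_simp
        rw [this]
        exact polySpan_mono (by omega) (mul_mem_polySpan hgδ hD)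
      · have : g * z * c = g * c * z := by ring
        rw [this]
        exact polySpan_mono (by omega) (mul_mem_polySpan (hB c hc) hE)

/-- A `p⁻¹`-linear map divides degrees by `p`, up to a bounded error. -/
lemma mul_map_mem_polySpan {C : K →+ K} (hC : ∀ a x, C (a ^ p * x) = a * C x) {g : K} {δ : ℕ}
    (hg : ∀ m : τ → ℕ, (∀ i, m i < p) → g * C (∏ i, t i ^ m i) ∈ polySpan p t δ) {D : ℕ} {x : K}
    (hx : x ∈ polySpan p t D) : g * C x ∈ polySpan p t (D / p + δ) := by
  have hp : 0 < p := (Fact.out : p.Prime).pos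
  induction hx using Submodule.span_induction with
  | mem x hx =>
    obtain ⟨m, hm, rfl⟩ := hx
    have h1 : ∏ i, t i ^ m i = (∏ i, t i ^ (m i / p)) ^ p * ∏ i, t i ^ (m i % p) := by
      rw [← Finset.prod_pow, ← Finset.prod_mul_distrib]
      refine Finset.prod_congr rfl fun i _ => ?_
      rw [← pow_mul, ← pow_add, Nat.div_add_mod']
    have h2 : ∏ i, t i ^ (m i / p) ∈ polySpan p t (D / p) := by
      refine Submodule.subset_span ⟨fun i => m i / p, ?_, rfl⟩
      rw [Nat.le_div_iff_mul_le hp, Finset.sum_mul]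
      exact (Finset.sum_le_sum fun i _ => Nat.div_mul_le_self (m i) p).trans hm
    rw [h1, hC, mul_left_comm]
    exact mul_mem_polySpan h2 (hg _ fun i => Nat.mod_lt _ hp)
  | zero => simp
  | add x y _ _ hx hy =>
    rw [map_add, mul_add]
    exact add_mem hx hy
  | smul c x _ hx =>
    rw [ZMod.map_smul, mul_smul_comm]
    exact Submodule.smul_mem _ c hx

/-- Over a finitely generated field there are `p⁻¹`-linear maps `C j` without a common zero and a
finite set `W` of elements that contains `t` and that is stable under all the maps
`w ↦ C j (w * t i ^ r)` with `r < p`. -/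
lemma exists_finite_stable_set (ht : Subfield.closure (Set.range t) = ⊤) :
    ∃ (k : ℕ) (C : Fin k → K →+ K) (W : Set K), (∀ j a x, C j (a ^ p * x) = a * C j x) ∧
      (∀ x, (∀ j, C j x = 0) → x = 0) ∧ W.Finite ∧ (∀ i, t i ∈ W) ∧
      ∀ j, ∀ w ∈ W, ∀ i, ∀ r < p, C j (w * t i ^ r) ∈ W := by
  classical
  have : CharP K p := charP_of_injective_algebraMap (algebraMap (ZMod p) K).injective p
  obtain ⟨k, C, hC, hC0⟩ := exists_frobeniusInverse_linear_maps p ht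
  have hp2 : 2 ≤ p := (Fact.out : p.Prime).two_le
  obtain ⟨δ, g, hg0, hgδ, hg⟩ := exists_common_denominator (p := p) ht
    ((Finset.univ : Finset (Fin k × (τ → Fin p))).image fun x => C x.1 (∏ i, t i ^ (x.2 i : ℕ)))
  have hmul : ∀ j, ∀ D, ∀ x ∈ polySpan p t D, g * C j x ∈ polySpan p t (D / p + δ) := by
    intro j D x hx
    refine mul_map_mem_polySpan (hC j) (fun m hm => ?_) hx
    exact hg _ (Finset.mem_image.mpr ⟨(j, fun i => ⟨m i, hm i⟩), Finset.mem_univ _, rfl⟩)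
  -- The degree bound `4 δ + 2` is large enough to be reproduced after division by `p`.
  refine ⟨k, C, {w | g ^ 2 * w ∈ polySpan p t (4 * δ + 2)}, hC, hC0, ?_, ?_, ?_⟩
  · refine Set.Finite.preimage (f := fun w => g ^ 2 * w) ?_ (finite_polySpan (4 * δ + 2))
    intro x _ y _ hxy
    exact mul_left_cancel₀ (pow_ne_zero 2 hg0) hxy
  · intro i
    exact polySpan_mono (by omega) (mul_mem_polySpan (pow_mem_polySpan hgδ 2) (mem_polySpan_one i))
  · intro j w hw i r hr
    have h1 : g ^ 2 * C j (w * t i ^ r) = g * C j (g ^ (p - 2) * (g ^ 2 * w) * t i ^ r) := by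
      have : g ^ (p - 2) * (g ^ 2 * w) * t i ^ r = g ^ p * (w * t i ^ r) := by
        rw [← mul_assoc, ← pow_add, Nat.sub_add_cancel hp2, mul_assoc]
      rw [this, hC]
      ring
    have h2 := hmul j ((p - 2) * δ + (4 * δ + 2) + r * 1) _ (mul_mem_polySpan
      (mul_mem_polySpan (pow_mem_polySpan hgδ (p - 2))
        (show g ^ 2 * w ∈ polySpan p t (4 * δ + 2) from hw))
      (pow_mem_polySpan (mem_polySpan_one (p := p) (t := t) i) r))
    change g ^ 2 * C j (w * t i ^ r) ∈ polySpan p t (4 * δ + 2)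
    rw [h1]
    refine polySpan_mono ?_ h2
    have h3 : ((p - 2) * δ + (4 * δ + 2) + r * 1) / p ≤ 3 * δ + 2 := by
      rw [Nat.div_le_iff_le_mul_add_pred (by omega)]
      obtain ⟨s, rfl⟩ := Nat.exists_eq_add_of_le hp2
      simp only [Nat.add_sub_cancel_left]
      nlinarith [Nat.zero_le (s * δ), Nat.zero_le s, Nat.zero_le δ, Nat.sub_add_cancel
        (show 1 ≤ 2 + s by omega)]
    omega

/-- The hyperplane of the vectors `y` with `∑ α i * y i = 0`. -/
def hyperplane {K ι : Type*} [Field K] [Fintype ι] (α : ι → K) : Submodule K (ι → K) :=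
  LinearMap.ker (Fintype.linearCombination K α)

lemma mem_hyperplane {K ι : Type*} [Field K] [Fintype ι] {α y : ι → K} :
    y ∈ hyperplane α ↔ ∑ i, α i * y i = 0 := by
  simp [hyperplane, Fintype.linearCombination_apply, mul_comm]

/-- Over a finitely generated field, only finitely many subspaces arise from a hyperplane by
reading digits in base `p`. -/
lemma exists_finite_states {K τ ι : Type*} [Field K] [Fintype τ] [Fintype ι] {p : ℕ}
    [Fact p.Prime] [CharP K p] {t : τ → K} (ht : Subfield.closure (Set.range t) = ⊤)
    {l α : ι → K} (hl : ∀ i, l i ∈ Set.range t) (hα : ∀ i, α i ∈ Set.range t) :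
    ∃ X : Set (Submodule K (ι → K)), X.Finite ∧ hyperplane α ∈ X ∧
      ∀ Y ∈ X, ∀ r < p, frobStep p l Y 1 r ∈ X := by
  let : Algebra (ZMod p) K := ZMod.algebra K p
  obtain ⟨k, C, W, hC, hC0, hW, htW, hCW⟩ := exists_finite_stable_set (p := p) ht
  let sol : Set (ι → K) → Submodule K (ι → K) := fun S => ⨅ v ∈ S, hyperplane v
  have hsol : ∀ S y, y ∈ sol S ↔ ∀ v ∈ S, ∑ i, v i * y i = 0 := by
    intro S y
    simp only [sol, Submodule.mem_iInf, mem_hyperplane]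
  have hWfin : (Set.univ.pi fun _ : ι => W).Finite := Set.Finite.pi fun _ => hW
  refine ⟨sol '' {S | S ⊆ Set.univ.pi fun _ : ι => W}, hWfin.finite_subsets.image _, ?_, ?_⟩
  · refine ⟨{α}, ?_, ?_⟩
    · intro v hv i _
      rw [Set.mem_singleton_iff.mp hv]
      obtain ⟨x, hx⟩ := hα i
      exact hx ▸ htW x
    · ext y
      rw [hsol, mem_hyperplane]
      simp
  · rintro _ ⟨S, hS, rfl⟩ r hr
    refine ⟨{u | ∃ v ∈ S, ∃ j, u = fun i => C j (v i * l i ^ r)}, ?_, ?_⟩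
    · rintro _ ⟨v, hv, j, rfl⟩ i _
      obtain ⟨x, hx⟩ := hl i
      change C j (v i * l i ^ r) ∈ W
      rw [← hx]
      exact hCW j _ (hS hv i trivial) x r hr
    · ext y
      rw [hsol, mem_frobStep, hsol]
      have key : ∀ v : ι → K, ∀ j, C j (∑ i, v i * (l ^ r * y ^ p ^ 1) i)
          = ∑ i, C j (v i * l i ^ r) * y i := by
        intro v j
        rw [map_sum]
        refine Finset.sum_congr rfl fun i _ => ?_
        have : v i * (l ^ r * y ^ p ^ 1) i = y i ^ p * (v i * l i ^ r) := by
          simp only [Pi.mul_apply, Pi.pow_apply, pow_one]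
          ring
        rw [this, hC, mul_comm]
      constructor
      · intro h v hv
        refine hC0 _ fun j => ?_
        rw [key]
        exact h _ ⟨v, hv, j, rfl⟩
      · rintro h _ ⟨v, hv, j, rfl⟩
        rw [← key, h v hv, map_zero]

end Finiteness

/-! ### Chain sets -/

section ChainSet

/-- The set of the integers `z₀ + q ^ k₁ * (z₁ + q ^ k₂ * (z₂ + ⋯))`, with arbitrary natural
exponents `k₁, k₂, …`. -/
def chainSet (q : ℕ) : ℤ → List ℤ → Set ℤ
  | z, [] => {z}
  | z, z' :: zs => {x | ∃ k : ℕ, ∃ y ∈ chainSet q z' zs, x = z + (q : ℤ) ^ k * y}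

/-- `S` is a finite union of chain sets of depth at most `m`. The coefficients of chain sets of
natural numbers lie in `(q - 1)⁻¹ ℤ`, so the multiple `(q - 1) S` is described instead. -/
def IsChainUnion (q m : ℕ) (S : Set ℕ) : Prop :=
  ∃ L : Set (ℤ × List ℤ), L.Finite ∧ (∀ c ∈ L, c.2.length ≤ m) ∧
    ∀ x : ℤ, (∃ c ∈ L, x ∈ chainSet q c.1 c.2) ↔ ∃ n ∈ S, x = ((q : ℤ) - 1) * (n : ℤ)

variable {q m : ℕ} {S : Set ℕ}

lemma mem_chainSet_nil {z x : ℤ} : x ∈ chainSet q z [] ↔ x = z := Iff.rfl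

lemma mem_chainSet_cons {z z' x : ℤ} {zs : List ℤ} :
    x ∈ chainSet q z (z' :: zs) ↔ ∃ k : ℕ, ∃ y ∈ chainSet q z' zs, x = z + (q : ℤ) ^ k * y :=
  Iff.rfl

lemma mem_chainSet_affine {r N z x : ℤ} {zs : List ℤ} :
    x ∈ chainSet q (r + N * z) (zs.map (N * ·)) ↔ ∃ y ∈ chainSet q z zs, x = r + N * y := by
  induction zs generalizing r z x with
  | nil => simp [mem_chainSet_nil]
  | cons z' zs ih =>
    have ih' : ∀ y, y ∈ chainSet q (N * z') (zs.map (N * ·)) ↔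
        ∃ w ∈ chainSet q z' zs, y = N * w := by
      intro y
      simpa using ih (r := 0) (z := z') (x := y)
    simp only [List.map_cons, mem_chainSet_cons, ih']
    constructor
    · rintro ⟨k, _, ⟨w, hw, rfl⟩, rfl⟩
      exact ⟨_, ⟨k, w, hw, rfl⟩, by ring⟩
    · rintro ⟨_, ⟨k, w, hw, rfl⟩, rfl⟩
      exact ⟨k, _, ⟨w, hw, rfl⟩, by ring⟩

lemma IsChainUnion.mono {m' : ℕ} (h : IsChainUnion q m S) (hm : m ≤ m') :
    IsChainUnion q m' S := by
  obtain ⟨L, hL, hlen, hS⟩ := h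
  exact ⟨L, hL, fun c hc => (hlen c hc).trans hm, hS⟩

lemma isChainUnion_of_finite (h : S.Finite) : IsChainUnion q m S := by
  refine ⟨(fun n : ℕ => (((q : ℤ) - 1) * n, [])) '' S, h.image _, ?_, ?_⟩
  · rintro _ ⟨n, _, rfl⟩
    simp
  · intro x
    constructor
    · rintro ⟨_, ⟨n, hn, rfl⟩, hx⟩
      exact ⟨n, hn, hx⟩
    · rintro ⟨n, hn, hx⟩
      exact ⟨_, ⟨n, hn, rfl⟩, hx⟩

lemma isChainUnion_biUnion {κ : Type*} {I : Set κ} (hI : I.Finite) {S : κ → Set ℕ}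
    (h : ∀ i ∈ I, IsChainUnion q m (S i)) : IsChainUnion q m (⋃ i ∈ I, S i) := by
  choose! L hL hlen hS using h
  refine ⟨⋃ i ∈ I, L i, hI.biUnion hL, ?_, ?_⟩
  · intro c hc
    simp only [Set.mem_iUnion] at hc
    obtain ⟨i, hi, hc⟩ := hc
    exact hlen i hi c hc
  · intro x
    constructor
    · rintro ⟨c, hc, hx⟩
      simp only [Set.mem_iUnion] at hc
      obtain ⟨i, hi, hc⟩ := hc
      obtain ⟨n, hn, hx⟩ := (hS i hi x).mp ⟨c, hc, hx⟩
      exact ⟨n, Set.mem_biUnion hi hn, hx⟩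
    · rintro ⟨n, hn, hx⟩
      simp only [Set.mem_iUnion] at hn
      obtain ⟨i, hi, hn⟩ := hn
      obtain ⟨c, hc, hx⟩ := (hS i hi x).mpr ⟨n, hn, hx⟩
      exact ⟨c, Set.mem_biUnion hi hc, hx⟩

lemma IsChainUnion.union {T : Set ℕ} (hS : IsChainUnion q m S) (hT : IsChainUnion q m T) :
    IsChainUnion q m (S ∪ T) := by
  rw [Set.union_eq_iUnion]
  have := isChainUnion_biUnion (q := q) (m := m) (Set.finite_univ (α := Bool))
    (S := fun b => cond b S T) (by rintro (_ | _) _ <;> assumption)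
  simpa using this

lemma IsChainUnion.affine (h : IsChainUnion q m S) (r N : ℕ) :
    IsChainUnion q m {x | ∃ s ∈ S, x = r + N * s} := by
  obtain ⟨L, hL, hlen, hS⟩ := h
  refine ⟨(fun c : ℤ × List ℤ => (((q : ℤ) - 1) * r + N * c.1, c.2.map ((N : ℤ) * ·))) '' L,
    hL.image _, ?_, ?_⟩
  · rintro _ ⟨c, hc, rfl⟩
    simpa using hlen c hc
  · intro x
    constructor
    · rintro ⟨_, ⟨c, hc, rfl⟩, hx⟩
      obtain ⟨y, hy, rfl⟩ := mem_chainSet_affine.mp hx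
      obtain ⟨n, hn, rfl⟩ := (hS y).mp ⟨c, hc, hy⟩
      exact ⟨_, ⟨n, hn, rfl⟩, by push_cast; ring⟩
    · rintro ⟨_, ⟨n, hn, rfl⟩, rfl⟩
      obtain ⟨c, hc, hx⟩ := (hS _).mpr ⟨n, hn, rfl⟩
      exact ⟨_, ⟨c, hc, rfl⟩, mem_chainSet_affine.mpr ⟨_, hx, by push_cast; ring⟩⟩

/-- The orbits of a chain union of depth `m` under `x ↦ n + q * x` form a chain union of depth
`m + 1`, since `(q - 1) φ ^ k (s) = - n + q ^ k * (n + (q - 1) s)` for this map `φ`. -/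
lemma IsChainUnion.orbit (h : IsChainUnion q m S) (n : ℕ) :
    IsChainUnion q (m + 1) {x | ∃ k, ∃ s ∈ S, x = (fun y => n + q * y)^[k] s} := by
  have hiter : ∀ k s : ℕ, ((q : ℤ) - 1) * ((fun y => n + q * y)^[k] s : ℕ)
      = -n + (q : ℤ) ^ k * (n + 1 * (((q : ℤ) - 1) * s)) := by
    intro k s
    induction k with
    | zero => simp
    | succ k ih =>
      rw [Function.iterate_succ_apply']
      push_cast
      linear_combination (q : ℤ) * ih
  obtain ⟨L, hL, hlen, hS⟩ := h
  refine ⟨(fun c : ℤ × List ℤ => (-(n : ℤ), (n + 1 * c.1) :: c.2.map ((1 : ℤ) * ·))) '' L,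
    hL.image _, ?_, ?_⟩
  · rintro _ ⟨c, hc, rfl⟩
    simpa using hlen c hc
  · intro x
    constructor
    · rintro ⟨_, ⟨c, hc, rfl⟩, k, y, hy, rfl⟩
      obtain ⟨w, hw, rfl⟩ := mem_chainSet_affine.mp hy
      obtain ⟨s, hs, rfl⟩ := (hS w).mp ⟨c, hc, hw⟩
      exact ⟨_, ⟨k, s, hs, rfl⟩, (hiter k s).symm⟩
    · rintro ⟨_, ⟨k, s, hs, rfl⟩, rfl⟩
      obtain ⟨c, hc, hx⟩ := (hS _).mpr ⟨s, hs, rfl⟩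
      exact ⟨_, ⟨c, hc, rfl⟩, k, _, mem_chainSet_affine.mpr ⟨_, hx, rfl⟩, hiter k s⟩

end ChainSet

/-! ### The structure of the set of exponents -/

section ExponentSet

open Nat in
/-- A path of length `X.ncard` in a finite set `X` of states visits a state that lies on a cycle.
All cycle lengths divide `X.ncard !`. -/
lemma exists_periodic_state {K ι : Type*} [Field K] {p : ℕ} [Fact p.Prime] [CharP K p]
    {l : ι → K} {X : Set (Submodule K (ι → K))} (hX : X.Finite)
    (hstep : ∀ Y ∈ X, ∀ r < p, frobStep p l Y 1 r ∈ X) {Y : Submodule K (ι → K)} (hY : Y ∈ X)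
    (u : ℕ) :
    ∃ i ≤ X.ncard, ∃ n < p ^ (X.ncard)!,
      frobStep p l (frobStep p l Y i (u % p ^ i)) (X.ncard)! n
        = frobStep p l Y i (u % p ^ i) := by
  have hp : 0 < p := (Fact.out : p.Prime).pos
  have hsplit : ∀ i j, i ≤ j → frobStep p l Y j (u % p ^ j)
      = frobStep p l (frobStep p l Y i (u % p ^ i)) (j - i) (u % p ^ j / p ^ i) := by
    intro i j hij
    have h1 : u % p ^ i = u % p ^ j % p ^ i := (Nat.mod_mod_of_dvd _ (pow_dvd_pow p hij)).symm
    rw [frobStep_frobStep, Nat.add_sub_cancel' hij, h1, Nat.mod_add_div]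
  have hlt : ∀ i j, i ≤ j → u % p ^ j / p ^ i < p ^ (j - i) := by
    intro i j hij
    rw [Nat.div_lt_iff_lt_mul (pow_pos hp i), ← pow_add, Nat.sub_add_cancel hij]
    exact Nat.mod_lt _ (pow_pos hp j)
  have hmem : ∀ j, frobStep p l Y j (u % p ^ j) ∈ X := by
    intro j
    induction j with
    | zero => simpa [Nat.mod_one, frobStep_zero_zero] using hY
    | succ j ih =>
      rw [hsplit j (j + 1) (Nat.le_succ j)]
      have := hlt j (j + 1) (Nat.le_succ j)
      rw [Nat.add_sub_cancel_left] at this ⊢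
      exact hstep _ ih _ (by simpa using this)
  obtain ⟨i, hi, j, hj, hij, h⟩ :
      ∃ i ∈ Finset.range (X.ncard + 1), ∃ j ∈ Finset.range (X.ncard + 1), i ≠ j ∧
        frobStep p l Y i (u % p ^ i) = frobStep p l Y j (u % p ^ j) := by
    refine Finset.exists_ne_map_eq_of_card_lt_of_maps_to (t := hX.toFinset) ?_ ?_
    · rw [Finset.card_range, ← Set.ncard_eq_toFinset_card X hX]
      omega
    · intro j _
      simpa using hmem j
  wlog hlt' : i < j generalizing i j
  · exact this j hj i hi hij.symm h.symm (by omega)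
  rw [Finset.mem_range] at hi hj
  refine ⟨i, by omega, ?_⟩
  set Y' := frobStep p l Y i (u % p ^ i)
  have hloop : ∀ k, ∃ n < p ^ ((j - i) * k), frobStep p l Y' ((j - i) * k) n = Y' := by
    intro k
    induction k with
    | zero => exact ⟨0, by simp, by simp [frobStep_zero_zero]⟩
    | succ k ih =>
      obtain ⟨n, hn, hk⟩ := ih
      refine ⟨n + p ^ ((j - i) * k) * (u % p ^ j / p ^ i), ?_, ?_⟩
      · rw [Nat.mul_succ, pow_add]
        calc n + p ^ ((j - i) * k) * (u % p ^ j / p ^ i)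
            < p ^ ((j - i) * k) * (u % p ^ j / p ^ i + 1) := by rw [mul_add]; omega
          _ ≤ _ := Nat.mul_le_mul_left _ (hlt i j hlt'.le)
      · rw [Nat.mul_succ, ← frobStep_frobStep, hk, ← hsplit i j hlt'.le, ← h]
  obtain ⟨k, hk⟩ := Nat.dvd_factorial (show 0 < j - i by omega) (show j - i ≤ X.ncard by omega)
  rw [hk]
  exact hloop k

variable {K ι : Type*} [Field K] {p : ℕ} [Fact p.Prime] [CharP K p] {l : ι → K}
  {X : Set (Submodule K (ι → K))}

lemma expSet_eq_biUnion (Y : Submodule K (ι → K)) (e : ℕ) :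
    expSet l Y = ⋃ u ∈ Set.Iio (p ^ e),
      {x | ∃ s ∈ expSet l (frobStep p l Y e u), x = u + (p ^ e : ℕ) * s} := by
  ext x
  simp only [Set.mem_iUnion, Set.mem_ofPred_eq, Set.mem_Iio]
  constructor
  · intro hx
    exact ⟨x % p ^ e, Nat.mod_lt _ (pow_pos (Fact.out : p.Prime).pos e), x / p ^ e,
      mem_expSet_iff_mod_div.mp hx, (Nat.mod_add_div _ _).symm⟩
  · rintro ⟨u, _, s, hs, rfl⟩
    exact add_mul_mem_expSet.mpr hs

open Nat in
/-- In the nondegenerate case, a periodic state has only one loop of a given length, and no path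
along which the dimension is constant leads away from this loop to another periodic state. -/
lemma finrank_lt_of_ne_loop [Fintype ι] (hl : ∀ i, l i ≠ 0)
    (hnd : ∀ i j n, 0 < n → l i ^ n = l j ^ n → i = j) (hX : X.Finite)
    (hstep : ∀ Y ∈ X, ∀ r < p, frobStep p l Y 1 r ∈ X) {Y : Submodule K (ι → K)}
    (htop : Y ≠ ⊤) (hZ : (expSet l Y).Nonempty) {n r : ℕ}
    (hn : n < p ^ (X.ncard)!) (hr : r < p ^ (X.ncard)!)
    (hloop : frobStep p l Y (X.ncard)! n = Y) (hne : r ≠ n)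
    (hYr : frobStep p l Y (X.ncard)! r ∈ X) (u : ℕ) :
    Module.finrank K (frobStep p l (frobStep p l Y (X.ncard)! r) X.ncard u)
      < Module.finrank K Y := by
  by_contra! hdim
  obtain ⟨i, hi, n', _, hper⟩ := exists_periodic_state hX hstep hYr u
  have h1 : u = u % p ^ i + p ^ i * (u / p ^ i) := (Nat.mod_add_div _ _).symm
  have hdim' : Module.finrank K Y ≤ Module.finrank K
      (frobStep p l (frobStep p l Y (X.ncard)! r) i (u % p ^ i)) := by
    refine hdim.trans ?_
    rw [h1, show X.ncard = i + (X.ncard - i) by omega, ← frobStep_frobStep, ← h1]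
    exact finrank_frobStep_le hl _ _
  rw [frobStep_frobStep (X.ncard)! r i] at hper hdim'
  set E := (X.ncard)!
  set R := r + p ^ E * (u % p ^ i) with hR
  -- Both sides describe the step from `Y` to the periodic state, preceded or followed by a loop.
  have hEq : frobStep p l Y (E + (E + i)) (n + p ^ E * R)
      = frobStep p l Y (E + (E + i)) (R + p ^ (E + i) * n') := by
    rw [← frobStep_frobStep, hloop, add_comm E (E + i), ← frobStep_frobStep (E + i) R, hper]
  have hfin : Module.finrank K Y
      ≤ Module.finrank K (frobStep p l Y (E + (E + i)) (n + p ^ E * R)) := by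
    rwa [← frobStep_frobStep, hloop]
  have hexp := frobStep_exponent_unique hl hnd htop hZ hEq hfin
  have hmod := congrArg (· % p ^ E) hexp
  simp only [hR, pow_add, mul_assoc, add_assoc, Nat.add_mul_mod_self_left, ← mul_add,
    Nat.mod_eq_of_lt hn, Nat.mod_eq_of_lt hr] at hmod
  exact hne hmod.symm

open Nat in
/-- The set of exponents of a proper subspace of dimension at most `d` is a chain union of depth
at most `d - 1`. In the induction on `d`, every path of length `X.ncard` meets a cycle, and only a
cycle increases the depth. -/
lemma isChainUnion_expSet [Fintype ι] (hl : ∀ i, l i ≠ 0)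
    (hnd : ∀ i j n, 0 < n → l i ^ n = l j ^ n → i = j) (hX : X.Finite)
    (hstep : ∀ Y ∈ X, ∀ r < p, frobStep p l Y 1 r ∈ X) (d : ℕ) (Y : Submodule K (ι → K))
    (hY : Y ∈ X) (htop : Module.finrank K Y < Fintype.card ι) (hd : Module.finrank K Y ≤ d) :
    IsChainUnion (p ^ (X.ncard)!) (d - 1) (expSet l Y) := by
  have hp : 0 < p := (Fact.out : p.Prime).pos
  have hne_top : ∀ {Y : Submodule K (ι → K)}, Module.finrank K Y < Fintype.card ι → Y ≠ ⊤ := by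
    rintro Y h rfl
    simp at h
  have hstep' : ∀ e, ∀ Y ∈ X, ∀ n < p ^ e, frobStep p l Y e n ∈ X := by
    intro e
    induction e with
    | zero =>
      intro Y hY n hn
      obtain rfl : n = 0 := by simpa using hn
      rwa [frobStep_zero_zero]
    | succ e ih =>
      intro Y hY n hn
      rw [← Nat.mod_add_div n (p ^ e), ← frobStep_frobStep]
      refine hstep _ (ih Y hY _ (Nat.mod_lt _ (pow_pos hp e))) _ ?_
      rw [Nat.div_lt_iff_lt_mul (pow_pos hp e), ← pow_succ']
      exact hn
  induction d using Nat.strong_induction_on generalizing Y with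
  | _ d ih =>
  obtain hd1 | hd2 := Nat.lt_or_ge d 2
  · exact isChainUnion_of_finite
      (subsingleton_expSet hl hnd (hne_top htop) (hd.trans (by omega))).finite
  obtain ⟨d, rfl⟩ := Nat.exists_eq_add_of_le' hd2
  set q := p ^ (X.ncard)! with hq
  have hq1 : 1 < q := Nat.one_lt_pow (Nat.factorial_pos _).ne' (Fact.out : p.Prime).one_lt
  -- On a loop with exponent `n`, the exponents are the orbits under `x ↦ n + q * x` of those
  -- exponents that leave the loop at once.
  have hperiodic : ∀ Y ∈ X, Module.finrank K Y < Fintype.card ι → Module.finrank K Y ≤ d + 2 →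
      ∀ n < q, frobStep p l Y (X.ncard)! n = Y → IsChainUnion q (d + 1) (expSet l Y) := by
    intro Y hY htop hd n hn hloop
    obtain hdim | hdim := Nat.lt_or_ge (Module.finrank K Y) (d + 2)
    · exact (ih (d + 1) (by omega) Y hY htop (by omega)).mono (by omega)
    obtain hZ | hZ := (expSet l Y).eq_empty_or_nonempty
    · rw [hZ]
      exact isChainUnion_of_finite Set.finite_empty
    let T : Set ℕ := (⋃ r ∈ {r | r < q ∧ r ≠ n},
      {x | ∃ s ∈ expSet l (frobStep p l Y (X.ncard)! r), x = r + q * s}) ∪ (expSet l Y ∩ {0})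
    have hT : IsChainUnion q d T := by
      refine (isChainUnion_biUnion ((Set.finite_Iio q).subset fun r hr => hr.1) ?_).union
        (isChainUnion_of_finite ((Set.finite_singleton 0).inter_of_right _))
      rintro r ⟨hr, hrn⟩
      refine IsChainUnion.affine ?_ r q
      have hYr : frobStep p l Y (X.ncard)! r ∈ X := hstep' _ Y hY r hr
      rw [expSet_eq_biUnion (p := p) _ X.ncard]
      refine isChainUnion_biUnion (Set.finite_Iio _) fun u hu => ?_
      refine IsChainUnion.affine ?_ u (p ^ X.ncard)
      have hlt := finrank_lt_of_ne_loop hl hnd hX hstep (hne_top htop) hZ hn hr hloop hrn hYr u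
      exact ih (d + 1) (by omega) _ (hstep' _ _ hYr u hu) (by omega) (by omega)
    have hmemT : ∀ x ∈ T, x ∈ expSet l Y := by
      rintro x (hx | hx)
      · rw [expSet_eq_biUnion (p := p) Y (X.ncard)!]
        simp only [Set.mem_iUnion] at hx ⊢
        obtain ⟨r, hr, hx⟩ := hx
        exact ⟨r, hr.1, hx⟩
      · exact hx.1
    have hloop_mem : ∀ x, n + q * x ∈ expSet l Y ↔ x ∈ expSet l Y := by
      intro x
      rw [hq, add_mul_mem_expSet, hloop]
    convert hT.orbit n using 1
    ext x
    constructor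
    · induction x using Nat.strong_induction_on with
      | _ x ihx =>
      intro hx
      by_cases h0 : x = 0
      · exact ⟨0, x, Or.inr ⟨hx, h0⟩, rfl⟩
      by_cases hxn : x % q = n
      · have hdecomp : x = n + q * (x / q) := by rw [← hxn, Nat.mod_add_div]
        obtain ⟨k, s, hs, hk⟩ := ihx (x / q) (Nat.div_lt_self (by omega) hq1)
          ((hloop_mem _).mp (hdecomp ▸ hx))
        refine ⟨k + 1, s, hs, ?_⟩
        rw [Function.iterate_succ_apply', ← hk]
        exact hdecomp
      · refine ⟨0, x, Or.inl ?_, rfl⟩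
        simp only [Set.mem_iUnion]
        exact ⟨x % q, ⟨Nat.mod_lt _ (by omega), hxn⟩, x / q, mem_expSet_iff_mod_div.mp hx,
          (Nat.mod_add_div _ _).symm⟩
    · rintro ⟨k, s, hs, rfl⟩
      induction k with
      | zero => exact hmemT s hs
      | succ k ihk =>
        rw [Function.iterate_succ_apply']
        exact (hloop_mem _).mpr ihk
  choose i hi n hn hper using fun u => exists_periodic_state hX hstep hY u
  have hunion : expSet l Y = ⋃ u ∈ Set.Iio (p ^ X.ncard),
      {x | ∃ s ∈ expSet l (frobStep p l Y (i u) (u % p ^ i u)),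
        x = u % p ^ i u + (p ^ i u : ℕ) * s} := by
    ext x
    simp only [Set.mem_iUnion, Set.mem_ofPred_eq, Set.mem_Iio]
    constructor
    · intro hx
      refine ⟨x % p ^ X.ncard, Nat.mod_lt _ (pow_pos hp _), ?_⟩
      set j := i (x % p ^ X.ncard)
      rw [Nat.mod_mod_of_dvd _ (pow_dvd_pow p (hi _))]
      exact ⟨x / p ^ j, mem_expSet_iff_mod_div.mp hx, (Nat.mod_add_div _ _).symm⟩
    · rintro ⟨u, _, s, hs, rfl⟩
      exact add_mul_mem_expSet.mpr hs
  rw [hunion]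
  refine isChainUnion_biUnion (Set.finite_Iio _) fun u _ => IsChainUnion.affine ?_ _ _
  have hle := finrank_frobStep_le (p := p) (Y := Y) hl (i u) (u % p ^ i u)
  exact hperiodic _ (hstep' _ Y hY _ (Nat.mod_lt _ (pow_pos hp _))) (by omega) (by omega)
    _ (hn u) (hper u)

end ExponentSet

/-! ### From chains of exponents to independent exponents -/

section FreeExponents

/-- Over an algebraically closed field of characteristic `p`, a linear relation between the powers
`ν i ^ (q ^ k)` that holds for all large `k` holds for all `k`: the vectors `ν ^ (q ^ k)` span a
finite-dimensional space, and a linear relation between them can be moved to smaller exponents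
by extracting roots of its coefficients. -/
lemma sum_mul_pow_eq_zero_of_le {F ι : Type*} [Field F] [IsAlgClosed F] [Fintype ι] {p : ℕ}
    [Fact p.Prime] [CharP F p] (e : ℕ) (β ν : ι → F) {k₀ : ℕ}
    (h : ∀ k, k₀ ≤ k → ∑ i, β i * ν i ^ (p ^ e) ^ k = 0) (k : ℕ) :
    ∑ i, β i * ν i ^ (p ^ e) ^ k = 0 := by
  have hp : 0 < p := (Fact.out : p.Prime).pos
  set q := p ^ e with hq
  have hq0 : 0 < q := pow_pos hp e
  -- A nontrivial relation between the vectors `ν ^ (q ^ j)`.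
  obtain ⟨P, hP0, hP⟩ : ∃ c : ℕ →₀ F, c ≠ 0 ∧ ∀ i, c.sum (fun j a => a * ν i ^ q ^ j) = 0 := by
    have hdep : ¬ LinearIndependent F (fun j : ℕ => (ν ^ q ^ j : ι → F)) := fun hli =>
      not_finite_iff_infinite.mpr (inferInstance : Infinite ℕ) hli.finite
    rw [linearIndependent_iff] at hdep
    push Not at hdep
    obtain ⟨c, hc, hc0⟩ := hdep
    refine ⟨c, hc0, fun i => ?_⟩
    have := congrFun hc i
    simpa [Finsupp.linearCombination_apply, Finsupp.sum, Finset.sum_apply] using this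
  -- After extracting roots, its smallest exponent is `0`.
  obtain ⟨c, s, hs, hc0, hc⟩ : ∃ (c : ℕ → F) (s : Finset ℕ), (∀ j ∈ s, 0 < j) ∧ c 0 ≠ 0 ∧
      ∀ i, c 0 * ν i + ∑ j ∈ s, c j * ν i ^ q ^ j = 0 := by
    have hne : P.support.Nonempty := Finsupp.support_nonempty_iff.mpr hP0
    set j₀ := P.support.min' hne
    have hj₀ : j₀ ∈ P.support := Finset.min'_mem _ _
    have hroot : ∀ j, ∃ z : F, z ^ q ^ j₀ = P j := fun j =>
      IsAlgClosed.exists_pow_nat_eq _ (pow_pos hq0 _)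
    choose b hb using hroot
    have hle : ∀ j ∈ P.support, j₀ ≤ j := fun j hj => Finset.min'_le _ _ hj
    have hinj : Set.InjOn (fun j => j - j₀) (P.support : Set ℕ) := by
      intro x hx y hy hxy
      have := hle x hx
      have := hle y hy
      dsimp at hxy
      omega
    have hsum : ∀ i, ∑ j ∈ P.support, b j * ν i ^ q ^ (j - j₀) = 0 := by
      intro i
      have h1 : (∑ j ∈ P.support, b j * ν i ^ q ^ (j - j₀)) ^ q ^ j₀ = 0 := by
        rw [hq, ← pow_mul, sum_pow_char_pow, ← hP i, Finsupp.sum]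
        refine Finset.sum_congr rfl fun j hj => ?_
        rw [pow_mul, ← hq, mul_pow, hb, ← pow_mul, ← pow_add, Nat.sub_add_cancel (hle j hj)]
      exact (pow_eq_zero_iff (pow_pos hq0 _).ne').mp h1
    refine ⟨fun j => b (j + j₀), (P.support.erase j₀).image (fun j => j - j₀), ?_, ?_, ?_⟩
    · intro j hj
      obtain ⟨x, hx, rfl⟩ := Finset.mem_image.mp hj
      have := hle x (Finset.mem_of_mem_erase hx)
      have := Finset.ne_of_mem_erase hx
      omega
    · intro h0
      dsimp only at h0
      rw [zero_add] at h0
      refine Finsupp.mem_support_iff.mp hj₀ ?_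
      rw [← hb, h0, zero_pow (pow_pos hq0 _).ne']
    · intro i
      rw [Finset.sum_image (hinj.mono (by exact_mod_cast Finset.erase_subset _ _)), ← hsum i,
        ← Finset.add_sum_erase _ _ hj₀]
      congr 1
      · simp
      · refine Finset.sum_congr rfl fun j hj => ?_
        dsimp only
        rw [Nat.sub_add_cancel (hle j (Finset.mem_of_mem_erase hj))]
  have hdown : ∀ n, ∀ k, k₀ ≤ k + n → ∑ i, β i * ν i ^ q ^ k = 0 := by
    intro n
    induction n with
    | zero => exact fun k hk => h k hk
    | succ n ih =>
      intro k hk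
      have hi : ∀ i, c 0 ^ q ^ k * ν i ^ q ^ k
          = - ∑ j ∈ s, c j ^ q ^ k * ν i ^ q ^ (k + j) := by
        intro i
        have h1 : (c 0 * ν i + ∑ j ∈ s, c j * ν i ^ q ^ j) ^ q ^ k = 0 := by
          rw [hc i, zero_pow (pow_pos hq0 _).ne']
        rw [hq, ← pow_mul, add_pow_char_pow, sum_pow_char_pow, pow_mul, ← hq] at h1
        rw [eq_neg_iff_add_eq_zero, ← h1, mul_pow]
        congr 1
        refine Finset.sum_congr rfl fun j _ => ?_
        rw [mul_pow, ← pow_mul (ν i), ← pow_add, add_comm k]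
      have hmul : c 0 ^ q ^ k * ∑ i, β i * ν i ^ q ^ k = 0 := by
        calc c 0 ^ q ^ k * ∑ i, β i * ν i ^ q ^ k
            = ∑ i, β i * (c 0 ^ q ^ k * ν i ^ q ^ k) := by
              rw [Finset.mul_sum]
              exact Finset.sum_congr rfl fun i _ => by ring
          _ = - ∑ j ∈ s, c j ^ q ^ k * ∑ i, β i * ν i ^ q ^ (k + j) := by
              simp only [hi, Finset.mul_sum, mul_neg, Finset.sum_neg_distrib]
              rw [Finset.sum_comm]
              congr 1
              refine Finset.sum_congr rfl fun j _ => Finset.sum_congr rfl fun i _ => by ring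
          _ = 0 := by
              rw [Finset.sum_eq_zero fun j hj => ?_, neg_zero]
              have := hs j hj
              rw [ih (k + j) (by omega), mul_zero]
      exact (mul_eq_zero.mp hmul).resolve_left (pow_ne_zero _ hc0)
  exact hdown k₀ k (by omega)

/-- The set of the integers `q ^ k₁ * z₁ + q ^ k₂ * z₂ + ⋯` with arbitrary natural exponents
`k₁, k₂, …`. -/
def freeSet (q : ℕ) : List ℤ → Set ℤ
  | [] => {0}
  | z :: zs => {x | ∃ k : ℕ, ∃ y ∈ freeSet q zs, x = (q : ℤ) ^ k * z + y}

/-- A linear relation that holds for all exponents in a chain set holds for all integers obtained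
by making the exponents of the powers of `q` independent. -/
lemma sum_zpow_eq_zero_of_chainSet {F ι : Type*} [Field F] [IsAlgClosed F] [Fintype ι] {p : ℕ}
    [Fact p.Prime] [CharP F p] {e : ℕ} {μ : ι → F} (hμ : ∀ i, μ i ≠ 0) {zs : List ℤ} {z : ℤ}
    (K : ℕ) (A : ι → F)
    (h : ∀ y ∈ chainSet (p ^ e) z zs, ∑ i, A i * μ i ^ (((p ^ e : ℕ) : ℤ) ^ K * y) = 0)
    {w : ℤ} (hw : w ∈ freeSet (p ^ e) zs) :
    ∑ i, A i * μ i ^ (((p ^ e : ℕ) : ℤ) ^ K * z + w) = 0 := by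
  set q := p ^ e with hq
  induction zs generalizing z K A w with
  | nil =>
    obtain rfl : w = 0 := hw
    simpa using h z rfl
  | cons z' zs ih =>
    obtain ⟨k, w, hw, rfl⟩ := hw
    have key : ∀ k', K ≤ k' →
        ∑ i, (A i * μ i ^ ((q : ℤ) ^ K * z + w)) * (μ i ^ z') ^ q ^ k' = 0 := by
      intro k' hk'
      have := ih (z := z') k' (fun i => A i * μ i ^ ((q : ℤ) ^ K * z)) ?_ hw
      · rw [← this]
        refine Finset.sum_congr rfl fun i _ => ?_
        rw [← zpow_natCast, ← zpow_mul, mul_assoc, mul_assoc, ← zpow_add₀ (hμ i),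
          ← zpow_add₀ (hμ i)]
        congr 2
        push_cast
        ring
      · intro y hy
        rw [← h _ ⟨k' - K, y, hy, rfl⟩]
        refine Finset.sum_congr rfl fun i _ => ?_
        rw [mul_assoc, ← zpow_add₀ (hμ i), mul_add, ← mul_assoc, ← pow_add,
          Nat.add_sub_cancel' hk']
    have := sum_mul_pow_eq_zero_of_le e _ _ key k
    rw [← this]
    refine Finset.sum_congr rfl fun i _ => ?_
    rw [← hq, ← zpow_natCast, ← zpow_mul, mul_assoc, ← zpow_add₀ (hμ i)]
    congr 2
    push_cast
    ring

lemma chainSet_subset_freeSet {q : ℕ} {zs : List ℤ} {z : ℤ} (j : ℕ) {x : ℤ}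
    (hx : x ∈ chainSet q z zs) :
    ∃ w ∈ freeSet q zs, (q : ℤ) ^ j * x = (q : ℤ) ^ j * z + w := by
  induction zs generalizing z j x with
  | nil => exact ⟨0, rfl, by rw [mem_chainSet_nil.mp hx, add_zero]⟩
  | cons z' zs ih =>
    obtain ⟨k, y, hy, rfl⟩ := hx
    obtain ⟨w, hw, h⟩ := ih (j + k) hy
    refine ⟨_, ⟨j + k, w, hw, rfl⟩, ?_⟩
    rw [← h]
    ring

lemma freeSet_filter {q : ℕ} {zs : List ℤ} :
    freeSet q (zs.filter (· ≠ 0)) = freeSet q zs := by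
  induction zs with
  | nil => rfl
  | cons z zs ih =>
    by_cases hz : z = 0
    · subst hz
      rw [List.filter_cons_of_neg (by simp), ih]
      ext x
      simp [freeSet]
    · rw [List.filter_cons_of_pos (by simpa using hz)]
      simp only [freeSet, ih]

lemma mem_freeSet_iff {q : ℕ} {zs : List ℤ} {x : ℤ} :
    x ∈ freeSet q zs ↔ ∃ k : Fin zs.length → ℕ, x = ∑ i, zs.get i * (q : ℤ) ^ k i := by
  induction zs generalizing x with
  | nil => simp [freeSet]
  | cons z zs ih =>
    constructor
    · rintro ⟨k, y, hy, rfl⟩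
      obtain ⟨k', rfl⟩ := ih.mp hy
      refine ⟨Fin.cons k k', ?_⟩
      simp [Fin.sum_univ_succ, mul_comm]
    · rintro ⟨k, rfl⟩
      refine ⟨k 0, _, ih.mpr ⟨fun i => k i.succ, rfl⟩, ?_⟩
      simp [Fin.sum_univ_succ, mul_comm]

/-- A set of natural numbers described by a free set is finite or elementary `p`-nested: if no
coefficient is positive, its elements are bounded. -/
lemma finite_or_isElementaryPNested {p e : ℕ} (hp : 1 < p) (he : 1 ≤ e) {z : ℤ} {zs : List ℤ}
    {S : Set ℕ} (hS : ∀ n : ℕ, n ∈ S ↔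
      ∃ w ∈ freeSet (p ^ e) zs, (((p ^ e : ℕ) : ℤ) - 1) * n = z + w) :
    S.Finite ∨ ∃ r ≤ zs.length, IsElementaryPNested p r S := by
  set q := p ^ e with hq
  have hq1 : 1 < q := Nat.one_lt_pow (by omega) hp
  rw [← freeSet_filter] at hS
  set ys := zs.filter (· ≠ 0) with hys
  have hy0 : ∀ i : Fin ys.length, ys.get i ≠ 0 := by
    intro i
    have := List.get_mem ys i
    simpa using (List.mem_filter.mp this).2
  simp only [mem_freeSet_iff] at hS
  by_cases hpos : ∃ i, 0 < ys.get i
  swap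
  · left
    push Not at hpos
    refine (Set.finite_Iic z.toNat).subset fun n hn => ?_
    obtain ⟨_, ⟨k, rfl⟩, hk⟩ := (hS n).mp hn
    have h1 : ∑ i, ys.get i * (q : ℤ) ^ k i ≤ 0 :=
      Finset.sum_nonpos fun i _ => mul_nonpos_of_nonpos_of_nonneg (hpos i) (by positivity)
    have h2 : (n : ℤ) ≤ ((q : ℤ) - 1) * n := by
      have : (1 : ℤ) ≤ (q : ℤ) - 1 := by omega
      nlinarith
    rw [Set.mem_Iic]
    omega
  obtain hemp | ⟨n₀, hn₀⟩ := S.eq_empty_or_nonempty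
  · exact Or.inl (hemp ▸ Set.finite_empty)
  right
  have hqQ : (q : ℚ) - 1 ≠ 0 := by
    have : (1 : ℚ) < q := by exact_mod_cast hq1
    linarith
  have hqpos : (0 : ℚ) < (q : ℚ) - 1 := by
    have : (1 : ℚ) < q := by exact_mod_cast hq1
    linarith
  obtain ⟨i₀, hi₀⟩ := hpos
  refine ⟨ys.length, List.length_filter_le _ _, by have := i₀.2; omega, q, e,
    (z : ℚ) / ((q : ℚ) - 1), fun i => (ys.get i : ℚ) / ((q : ℚ) - 1), he, hq,
    ⟨z, mul_div_cancel₀ _ hqQ⟩, fun i => ⟨ys.get i, mul_div_cancel₀ _ hqQ⟩, ?_, ?_, ?_, ?_⟩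
  · obtain ⟨_, ⟨k, rfl⟩, hk⟩ := (hS n₀).mp hn₀
    have hdvd : (q : ℤ) - 1 ∣ z + ∑ i, ys.get i := by
      have h1 : (q : ℤ) - 1 ∣ ∑ i, ys.get i * ((q : ℤ) ^ k i - 1) := by
        refine Finset.dvd_sum fun i _ => Dvd.dvd.mul_left ?_ _
        simpa using sub_dvd_pow_sub_pow (q : ℤ) 1 (k i)
      have h2 : z + ∑ i, ys.get i
          = ((q : ℤ) - 1) * n₀ - ∑ i, ys.get i * ((q : ℤ) ^ k i - 1) := by
        simp only [mul_sub, mul_one, Finset.sum_sub_distrib]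
        linarith
      rw [h2]
      exact dvd_sub (dvd_mul_right _ _) h1
    obtain ⟨c, hc⟩ := hdvd
    refine ⟨c, ?_⟩
    rw [← Finset.sum_div, ← add_div, div_eq_iff hqQ]
    have := congrArg (Int.cast : ℤ → ℚ) hc
    push_cast at this
    rw [this, mul_comm]
  · intro i
    exact div_ne_zero (by exact_mod_cast hy0 i) hqQ
  · exact ⟨i₀, div_pos (by exact_mod_cast hi₀) hqpos⟩
  · ext n
    rw [hS, nestedSet, Set.mem_ofPred_eq]
    have key : ∀ k : Fin ys.length → ℕ,
        ((q : ℤ) - 1) * n = z + ∑ i, ys.get i * (q : ℤ) ^ k i ↔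
          (n : ℚ) = (z : ℚ) / ((q : ℚ) - 1)
            + ∑ i, (ys.get i : ℚ) / ((q : ℚ) - 1) * (q : ℚ) ^ k i := by
      intro k
      simp only [div_mul_eq_mul_div]
      rw [← Finset.sum_div, ← add_div, eq_div_iff hqQ, mul_comm (n : ℚ)]
      exact_mod_cast Iff.rfl
    constructor
    · rintro ⟨_, ⟨k, rfl⟩, hk⟩
      exact ⟨k, (key k).mp hk⟩
    · rintro ⟨k, hk⟩
      exact ⟨_, ⟨k, rfl⟩, (key k).mpr hk⟩

/-- If the zero set of an exponential sum is a chain union, then it is, up to finitely many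
elements, a finite union of elementary `p`-nested sets. -/
lemma exists_elementary_of_isChainUnion {F ι : Type*} [Field F] [Fintype ι]
    {p : ℕ} [Fact p.Prime] [CharP F p] {e m : ℕ} (he : 1 ≤ e) {l α : ι → F} (hl : ∀ i, l i ≠ 0)
    (h : IsChainUnion (p ^ e) m {n : ℕ | ∑ i, α i * l i ^ n = 0}) :
    ∃ 𝒰 : Set (Set ℕ), 𝒰.Finite ∧ (∀ U ∈ 𝒰, U.Finite ∨ ∃ r ≤ m, IsElementaryPNested p r U) ∧
      {n : ℕ | ∑ i, α i * l i ^ n = 0} = ⋃₀ 𝒰 := by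
  have hp1 : 1 < p := (Fact.out : p.Prime).one_lt
  set q := p ^ e with hq
  have hq1 : 1 < q := Nat.one_lt_pow (by omega) hp1
  set Z := {n : ℕ | ∑ i, α i * l i ^ n = 0} with hZ
  -- Exponents in `(q - 1)⁻¹ ℤ` make sense after passing to roots of order `q - 1`.
  let F' := AlgebraicClosure F
  have : CharP F' p := charP_of_injective_algebraMap (algebraMap F F').injective p
  have hroot : ∀ i, ∃ z : F', z ^ (q - 1) = algebraMap F F' (l i) := fun i =>
    IsAlgClosed.exists_pow_nat_eq _ (by omega)
  choose μ hμ using hroot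
  have hμ0 : ∀ i, μ i ≠ 0 := by
    intro i h0
    have := hμ i
    rw [h0, zero_pow (by omega), eq_comm, map_eq_zero] at this
    exact hl i this
  have hmem : ∀ n : ℕ, n ∈ Z ↔
      ∑ i, algebraMap F F' (α i) * μ i ^ (((q : ℤ) - 1) * n) = 0 := by
    intro n
    rw [hZ, Set.mem_ofPred_eq, ← map_eq_zero (algebraMap F F'), map_sum]
    refine Eq.congr_left (Finset.sum_congr rfl fun i _ => ?_)
    rw [map_mul, map_pow, ← hμ, ← pow_mul, ← zpow_natCast]
    congr 2
    push_cast [Nat.cast_sub hq1.le]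
    ring
  obtain ⟨L, hL, hlen, hLZ⟩ := h
  let U : ℤ × List ℤ → Set ℕ := fun c =>
    {n | ∃ w ∈ freeSet q c.2, ((q : ℤ) - 1) * n = c.1 + w}
  refine ⟨U '' L, hL.image U, ?_, ?_⟩
  · rintro _ ⟨c, hc, rfl⟩
    obtain h | ⟨r, hr, h⟩ := finite_or_isElementaryPNested (S := U c) hp1 he (fun n => Iff.rfl)
    · exact Or.inl h
    · exact Or.inr ⟨r, hr.trans (hlen c hc), h⟩
  · ext n
    constructor
    · intro hn
      obtain ⟨c, hc, hx⟩ := (hLZ _).mpr ⟨n, hn, rfl⟩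
      refine ⟨U c, ⟨c, hc, rfl⟩, ?_⟩
      obtain ⟨w, hw, h⟩ := chainSet_subset_freeSet 0 hx
      exact ⟨w, hw, by simpa using h⟩
    · rintro ⟨_, ⟨c, hc, rfl⟩, w, hw, h⟩
      rw [hmem, h]
      have := sum_zpow_eq_zero_of_chainSet (p := p) (e := e) hμ0 (z := c.1) 0
        (fun i => algebraMap F F' (α i)) ?_ hw
      · simpa using this
      · intro y hy
        obtain ⟨n', hn', rfl⟩ := (hLZ y).mp ⟨c, hc, hy⟩
        simpa using (hmem n').mp hn'

end FreeExponents

/-! ### Exponential sums -/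

section ExponentialSums

/-- The zero set of a nontrivial exponential sum whose bases `l i` have no roots of unity among
their quotients is a finite union of finite sets and elementary `p`-nested sets. -/
lemma exists_elementary_of_nondegenerate {F ι : Type*} [Field F] [Fintype ι] {p : ℕ}
    [Fact p.Prime] [CharP F p] {l α : ι → F} (hl : ∀ i, l i ≠ 0)
    (hnd : ∀ i j n, 0 < n → l i ^ n = l j ^ n → i = j) (hα : α ≠ 0) :
    ∃ 𝒰 : Set (Set ℕ), 𝒰.Finite ∧
      (∀ U ∈ 𝒰, U.Finite ∨ ∃ r ≤ Fintype.card ι - 2, IsElementaryPNested p r U) ∧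
      {n : ℕ | ∑ i, α i * l i ^ n = 0} = ⋃₀ 𝒰 := by
  -- Everything takes place in the finitely generated subfield `K`.
  let K := Subfield.closure (Set.range (Sum.elim l α))
  have : CharP K p :=
    (RingHom.charP_iff K.subtype K.subtype.injective p).mpr inferInstance
  let t : ι ⊕ ι → K := fun i => ⟨Sum.elim l α i, Subfield.subset_closure ⟨i, rfl⟩⟩
  have ht : Subfield.closure (Set.range t) = ⊤ := by
    have hmap : (Subfield.closure (Set.range t)).map K.subtype = K := by
      rw [RingHom.map_field_closure, ← Set.range_comp]
      rfl
    rw [eq_top_iff]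
    intro x _
    have hx : (x : F) ∈ (Subfield.closure (Set.range t)).map K.subtype := by
      rw [hmap]
      exact x.2
    obtain ⟨y, hy, hyx⟩ := hx
    obtain rfl : y = x := Subtype.ext hyx
    exact hy
  let l' : ι → K := fun i => t (Sum.inl i)
  let α' : ι → K := fun i => t (Sum.inr i)
  have hl' : ∀ i, l' i ≠ 0 := fun i h => hl i (congrArg Subtype.val h)
  have hnd' : ∀ i j n, 0 < n → l' i ^ n = l' j ^ n → i = j := by
    intro i j n hn h
    exact hnd i j n hn (by simpa [l', t] using congrArg Subtype.val h)
  have hZ : {n : ℕ | ∑ i, α i * l i ^ n = 0} = {n : ℕ | ∑ i, α' i * l' i ^ n = 0} := by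
    ext n
    have : ((∑ i, α' i * l' i ^ n : K) : F) = ∑ i, α i * l i ^ n := by
      push_cast
      rfl
    simp only [Set.mem_ofPred_eq]
    rw [← this]
    exact_mod_cast Iff.rfl
  obtain ⟨X, hX, hαX, hstep⟩ := exists_finite_states (p := p) ht (l := l') (α := α')
    (fun i => ⟨_, rfl⟩) (fun i => ⟨_, rfl⟩)
  have htop : hyperplane α' ≠ ⊤ := by
    classical
    intro h
    refine hα (funext fun i => ?_)
    have : Pi.single i 1 ∈ hyperplane α' := h ▸ Submodule.mem_top
    rw [mem_hyperplane] at this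
    have h0 : α' i = 0 := by simpa [Pi.single_apply] using this
    exact congrArg Subtype.val h0
  have hfin : Module.finrank K (hyperplane α') < Fintype.card ι := by
    simpa using Submodule.finrank_lt htop
  have hchain := isChainUnion_expSet hl' hnd' hX hstep (Fintype.card ι - 1) _ hαX hfin (by omega)
  have hexp : expSet l' (hyperplane α') = {n : ℕ | ∑ i, α' i * l' i ^ n = 0} := by
    ext n
    rw [mem_expSet, mem_hyperplane]
    rfl
  rw [hexp, Nat.sub_sub] at hchain
  rw [hZ]
  exact exists_elementary_of_isChainUnion (Nat.factorial_pos _) hl' hchain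

/-- `S` is, up to a finite set, the union of finitely many infinite arithmetic progressions and
elementary `p`-nested sets of order at most `m`. -/
def IsAlmostUnion (p : ℕ) (m : ℤ) (S : Set ℕ) : Prop :=
  ∃ 𝒰 : Set (Set ℕ), 𝒰.Finite ∧
    (∀ U ∈ 𝒰, IsInfiniteAP U ∨ ∃ r : ℕ, (r : ℤ) ≤ m ∧ IsElementaryPNested p r U) ∧
    (symmDiff S (⋃₀ 𝒰)).Finite

variable {p : ℕ} {m : ℤ} {S T : Set ℕ}

lemma IsAlmostUnion.isPNormalOfOrderLE (h : IsAlmostUnion p m S) : IsPNormalOfOrderLE p m S := by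
  obtain ⟨𝒰, h𝒰, hU, hS⟩ := h
  set 𝒩 := {U ∈ 𝒰 | ∃ r : ℕ, (r : ℤ) ≤ m ∧ IsElementaryPNested p r U}
  set 𝒜 := {U ∈ 𝒰 | IsInfiniteAP U}
  refine ⟨⋃₀ 𝒩, 𝒜, ⟨∅, 𝒩, Set.finite_empty, h𝒰.subset fun U hU => hU.1, fun U hU => hU.2,
    (Set.empty_union _).symm⟩, h𝒰.subset fun U hU => hU.1, fun U hU => hU.2, ?_⟩
  rw [← Set.sUnion_union]
  convert hS using 3
  ext U
  constructor
  · rintro (h | h) <;> exact h.1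
  · intro h
    exact (hU U h).elim (fun h' => Or.inr ⟨h, h'⟩) (fun h' => Or.inl ⟨h, h'⟩)

lemma IsAlmostUnion.mono {m' : ℤ} (h : IsAlmostUnion p m S) (hm : m ≤ m') :
    IsAlmostUnion p m' S := by
  obtain ⟨𝒰, h𝒰, hU, hS⟩ := h
  exact ⟨𝒰, h𝒰, fun U hU' => (hU U hU').imp_right fun ⟨r, hr, h⟩ => ⟨r, hr.trans hm, h⟩, hS⟩

lemma IsAlmostUnion.of_symmDiff (h : IsAlmostUnion p m T) (hST : (symmDiff S T).Finite) :
    IsAlmostUnion p m S := by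
  obtain ⟨𝒰, h𝒰, hU, hS⟩ := h
  exact ⟨𝒰, h𝒰, hU, (hST.union hS).subset (symmDiff_triangle S T _)⟩

lemma isAlmostUnion_univ : IsAlmostUnion p m Set.univ := by
  refine ⟨{Set.univ}, Set.finite_singleton _, ?_, ?_⟩
  · rintro U hU
    rw [Set.mem_singleton_iff.mp hU]
    exact Or.inl ⟨0, 1, one_pos, by ext x; simp⟩
  · simp

lemma IsInfiniteAP.image (h : IsInfiniteAP S) {r N : ℕ} (hN : 0 < N) :
    IsInfiniteAP ((fun x => r + N * x) '' S) := by
  obtain ⟨m, n, hn, rfl⟩ := h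
  refine ⟨r + N * m, N * n, Nat.mul_pos hN hn, ?_⟩
  ext x
  constructor
  · rintro ⟨_, ⟨k, rfl⟩, rfl⟩
    exact ⟨k, by ring⟩
  · rintro ⟨k, rfl⟩
    exact ⟨_, ⟨k, rfl⟩, by ring⟩

/-- The values of an elementary `p`-nested set are integers. As `r < N`, a negative value is not
mapped to a natural number by `x ↦ r + N * x`. -/
lemma IsElementaryPNested.image {k : ℕ} (h : IsElementaryPNested p k S) {r N : ℕ} (hr : r < N) :
    IsElementaryPNested p k ((fun x => r + N * x) '' S) := by
  obtain ⟨hk, q, e, c₀, c, he, hq, ⟨z₀, hz₀⟩, hz, ⟨z, hzsum⟩, hc0, ⟨i, hi⟩, rfl⟩ := h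
  have hN : (0 : ℚ) < N := by exact_mod_cast (Nat.zero_le r).trans_lt hr
  have hint : ∀ j : Fin k → ℕ, ∃ y : ℤ, c₀ + ∑ i, c i * (q : ℚ) ^ j i = y := by
    intro j
    choose w hw using hz
    have hgeom : ∀ i, ∃ y : ℤ, c i * (q : ℚ) ^ j i - c i = y := by
      intro i
      refine ⟨w i * ∑ x ∈ Finset.range (j i), (q : ℤ) ^ x, ?_⟩
      push_cast
      rw [← hw i]
      have := geom_sum_mul (q : ℚ) (j i)
      linear_combination -(c i) * this
    choose y hy using hgeom
    refine ⟨z + ∑ i, y i, ?_⟩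
    push_cast
    rw [← hzsum]
    simp only [← hy, Finset.sum_sub_distrib]
    ring
  refine ⟨hk, q, e, r + N * c₀, fun i => N * c i, he, hq, ⟨((q : ℤ) - 1) * r + N * z₀, ?_⟩, ?_,
    ⟨r + N * z, ?_⟩, fun i => mul_ne_zero hN.ne' (hc0 i), ⟨i, mul_pos hN hi⟩, ?_⟩
  · push_cast
    rw [← hz₀]
    ring
  · intro i
    obtain ⟨w, hw⟩ := hz i
    refine ⟨N * w, ?_⟩
    push_cast
    rw [← hw]
    ring
  · push_cast
    rw [← hzsum, ← Finset.mul_sum]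
    ring
  · have hlin : ∀ j : Fin k → ℕ, (r + N * c₀ : ℚ) + ∑ i, N * c i * (q : ℚ) ^ j i
        = r + N * (c₀ + ∑ i, c i * (q : ℚ) ^ j i) := by
      intro j
      simp only [mul_assoc, ← Finset.mul_sum]
      ring
    ext x
    constructor
    · rintro ⟨n, ⟨j, hj⟩, rfl⟩
      refine ⟨j, ?_⟩
      rw [hlin, ← hj]
      push_cast
      ring
    · rintro ⟨j, hj⟩
      rw [hlin] at hj
      obtain ⟨y, hy⟩ := hint j
      rw [hy] at hj
      have hj' : (x : ℤ) = r + N * y := by exact_mod_cast hj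
      have hy0 : 0 ≤ y := by
        by_contra! hneg
        have : (r : ℤ) < N := by exact_mod_cast hr
        nlinarith [Int.natCast_nonneg x]
      lift y to ℕ using hy0
      exact ⟨y, ⟨j, by rw [hy]; simp⟩, by exact_mod_cast hj'.symm⟩

/-- The residue classes modulo `N` can be treated separately. -/
lemma isAlmostUnion_of_residues {N : ℕ} (hN : 0 < N)
    (h : ∀ r < N, IsAlmostUnion p m {k | r + N * k ∈ S}) : IsAlmostUnion p m S := by
  choose! 𝒰 h𝒰 hU hS using h
  refine ⟨⋃ r ∈ Set.Iio N, (fun U => (fun x => r + N * x) '' U) '' 𝒰 r,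
    (Set.finite_Iio N).biUnion fun r hr => (h𝒰 r hr).image _, ?_, ?_⟩
  · intro V hV
    simp only [Set.mem_iUnion] at hV
    obtain ⟨r, hr, U, hU', rfl⟩ := hV
    exact (hU r hr U hU').imp (fun h => h.image hN) fun ⟨k, hk, h⟩ => ⟨k, hk, h.image hr⟩
  · refine Set.Finite.subset (s := ⋃ r ∈ Set.Iio N, (fun x => r + N * x) ''
      symmDiff {k | r + N * k ∈ S} (⋃₀ 𝒰 r))
      ((Set.finite_Iio N).biUnion fun r hr => (hS r hr).image _) ?_
    intro n hn
    have hmem : n ∈ ⋃₀ (⋃ r ∈ Set.Iio N, (fun U => (fun x => r + N * x) '' U) '' 𝒰 r) ↔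
        n / N ∈ ⋃₀ 𝒰 (n % N) := by
      constructor
      · rintro ⟨_, hV, hnV⟩
        simp only [Set.mem_iUnion] at hV
        obtain ⟨r, hr, U, hU', rfl⟩ := hV
        obtain ⟨x, hx, rfl⟩ := hnV
        have hr' : r < N := hr
        refine ⟨U, ?_, ?_⟩
        · simpa [Nat.mod_eq_of_lt hr'] using hU'
        · simpa [Nat.add_mul_div_left _ _ hN, Nat.div_eq_of_lt hr'] using hx
      · rintro ⟨U, hU', hx⟩
        refine ⟨(fun x => n % N + N * x) '' U, ?_, n / N, hx, Nat.mod_add_div _ _⟩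
        simp only [Set.mem_iUnion]
        exact ⟨n % N, Nat.mod_lt _ hN, U, hU', rfl⟩
    simp only [Set.mem_iUnion]
    refine ⟨n % N, Nat.mod_lt _ hN, n / N, ?_, Nat.mod_add_div _ _⟩
    rw [Set.mem_symmDiff] at hn ⊢
    rwa [hmem, show (n ∈ S ↔ n / N ∈ {k | n % N + N * k ∈ S}) by
      rw [Set.mem_ofPred_eq, Nat.mod_add_div]] at hn

/-- The zero set of an exponential sum with arbitrary nonzero bases. On residue classes modulo a
common order `N` of all roots of unity among the quotients of the bases, the terms whose bases
have the same `N`-th power can be merged, and the sum becomes trivial or nondegenerate. -/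
lemma isAlmostUnion_exponentialSum {F ι : Type*} [Field F] [Fact p.Prime] [CharP F p]
    (s : Finset ι) (β v : ι → F) (hv : ∀ i ∈ s, v i ≠ 0) :
    IsAlmostUnion p ((s.card : ℤ) - 2) {n : ℕ | ∑ i ∈ s, β i * v i ^ n = 0} := by
  classical
  obtain ⟨N, hN, hNs⟩ : ∃ N, 0 < N ∧ ∀ i ∈ s, ∀ j ∈ s, ∀ k, 0 < k → v i ^ k = v j ^ k →
      v i ^ N = v j ^ N := by
    have h1 : ∀ x : ι × ι, ∃ k, 0 < k ∧ ((∃ k, 0 < k ∧ v x.1 ^ k = v x.2 ^ k) →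
        v x.1 ^ k = v x.2 ^ k) := by
      intro x
      by_cases h : ∃ k, 0 < k ∧ v x.1 ^ k = v x.2 ^ k
      · obtain ⟨k, hk, hx⟩ := h
        exact ⟨k, hk, fun _ => hx⟩
      · exact ⟨1, one_pos, fun h' => absurd h' h⟩
    choose k hk hkx using h1
    refine ⟨∏ x ∈ s ×ˢ s, k x, Finset.prod_pos fun x _ => hk x, ?_⟩
    intro i hi j hj n hn hij
    obtain ⟨c, hc⟩ := Finset.dvd_prod_of_mem k (Finset.mk_mem_product hi hj)
    rw [hc, pow_mul, pow_mul, hkx (i, j) ⟨n, hn, hij⟩]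
  refine isAlmostUnion_of_residues hN fun r _ => ?_
  set s' := s.image fun i => v i ^ N with hs'
  let α : s' → F := fun x => ∑ i ∈ s with v i ^ N = x, β i * v i ^ r
  have hsum : {k | r + N * k ∈ {n : ℕ | ∑ i ∈ s, β i * v i ^ n = 0}}
      = {k | ∑ x, α x * (x : F) ^ k = 0} := by
    ext k
    have : ∑ i ∈ s, β i * v i ^ (r + N * k) = ∑ x, α x * (x : F) ^ k := by
      rw [Finset.univ_eq_attach, Finset.sum_attach s'
        (fun x => (∑ i ∈ s with v i ^ N = x, β i * v i ^ r) * x ^ k),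
        ← Finset.sum_fiberwise_of_maps_to (t := s') (g := fun i => v i ^ N)
          fun i hi => Finset.mem_image_of_mem _ hi]
      refine Finset.sum_congr rfl fun x _ => ?_
      rw [Finset.sum_mul]
      refine Finset.sum_congr rfl fun i hi => ?_
      rw [← (Finset.mem_filter.mp hi).2, pow_add, pow_mul, mul_assoc]
    simp only [Set.mem_ofPred_eq, this]
  rw [hsum]
  by_cases hα : α = 0
  · convert isAlmostUnion_univ
    simp [hα]
  have hcard : s'.card ≤ s.card := Finset.card_image_le
  have hl : ∀ x : s', (x : F) ≠ 0 := by
    rintro ⟨x, hx⟩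
    obtain ⟨i, hi, rfl⟩ := Finset.mem_image.mp hx
    exact pow_ne_zero _ (hv i hi)
  have hnd : ∀ (x y : s') (n : ℕ), 0 < n → (x : F) ^ n = (y : F) ^ n → x = y := by
    rintro ⟨x, hx⟩ ⟨y, hy⟩ n hn hxy
    obtain ⟨i, hi, rfl⟩ := Finset.mem_image.mp hx
    obtain ⟨j, hj, rfl⟩ := Finset.mem_image.mp hy
    simp only [← pow_mul] at hxy
    exact Subtype.ext (hNs i hi j hj _ (Nat.mul_pos hN hn) hxy)
  obtain ⟨𝒰, h𝒰, hU, hZ⟩ := exists_elementary_of_nondegenerate (p := p) hl hnd hα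
  rw [hZ]
  refine ⟨{U ∈ 𝒰 | ¬ U.Finite}, h𝒰.subset fun U hU => hU.1, ?_, ?_⟩
  · rintro U ⟨hU', hinf⟩
    obtain ⟨k, hk, hel⟩ := (hU U hU').resolve_left hinf
    refine Or.inr ⟨k, ?_, hel⟩
    have := hel.1
    rw [Fintype.card_coe] at hk
    omega
  · refine (Set.Finite.sUnion (s := {U ∈ 𝒰 | U.Finite}) (h𝒰.subset fun U hU => hU.1)
      fun U hU => hU.2).subset ?_
    rintro n (⟨⟨U, hU', hn⟩, hn'⟩ | ⟨⟨U, hU', hn⟩, hn'⟩)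
    · refine ⟨U, ⟨hU', ?_⟩, hn⟩
      by_contra hinf
      exact hn' ⟨U, ⟨hU', hinf⟩, hn⟩
    · exact absurd ⟨U, hU'.1, hn⟩ hn'

end ExponentialSums

/-! ### Linear recurrences -/

section Recurrence

open Polynomial

/-- Along residue classes modulo a power `q ≥ d` of `p`, a recurrence sequence of order `d` is an
exponential sum without polynomial coefficients: the characteristic polynomial divides
`∏ (X - x) ^ q = ∏ (X ^ q - x ^ q)`, where `x` runs over its distinct roots, and the polynomial
`∏ (X - x ^ q)` has simple roots, so that Lagrange interpolation computes `X ^ n` modulo it. -/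
lemma exists_exponentialSum_of_isSolution {F : Type*} [Field F] [IsAlgClosed F] {p : ℕ}
    [Fact p.Prime] [CharP F p] (E : LinearRecurrence F) {a : ℕ → F} (ha : E.IsSolution a) :
    ∃ (s : Finset F) (q : ℕ), s.card ≤ E.order ∧ 0 < q ∧
      ∀ r, ∃ β : F → F, ∀ n, a (r + q * n) = ∑ x ∈ s, β x * (x ^ q) ^ n := by
  classical
  have hp : p.Prime := Fact.out
  set f := E.charPoly with hf
  have hdeg : f.natDegree = E.order := natDegree_eq_of_degree_eq_some E.charPoly_degree_eq_order
  set s := f.roots.toFinset with hs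
  set q := p ^ E.order with hq
  have hcard : f.roots.card ≤ E.order := hdeg ▸ f.card_roots'
  have hqE : E.order ≤ q := (Nat.lt_pow_self hp.one_lt).le
  let S : Module.End F (ℕ → F) := LinearMap.funLeft F F Nat.succ
  have hS : ∀ n b k, (aeval S (X ^ n : F[X]) b) k = b (k + n) := by
    intro n
    induction n with
    | zero => intro b k; simp
    | succ n ih =>
      intro b k
      rw [pow_succ, map_mul, Module.End.mul_apply, ih, aeval_X]
      rfl
  have hfa : aeval S f a = 0 := by
    ext k
    have hmon : ∀ n c, (aeval S (monomial n c : F[X]) a) k = c * a (k + n) := by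
      intro n c
      rw [← C_mul_X_pow_eq_monomial, map_mul, aeval_C, Module.End.mul_apply,
        Module.algebraMap_end_apply, Pi.smul_apply, hS, smul_eq_mul]
    rw [hf, LinearRecurrence.charPoly, map_sub, map_sum, LinearMap.sub_apply,
      LinearMap.sum_apply, Pi.sub_apply, Finset.sum_apply, hmon, one_mul, ha k]
    refine sub_eq_zero.mpr ?_
    exact Finset.sum_congr rfl fun i _ => (hmon _ _).symm
  have hdvd : f ∣ (∏ x ∈ s, (X - C (x ^ q))).comp (X ^ q) := by
    have h1 : f = ∏ x ∈ s, (X - C x) ^ f.roots.count x := by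
      rw [hs, ← Finset.prod_multiset_map_count]
      conv_lhs => rw [(IsAlgClosed.splits f).eq_prod_roots, E.charPoly_monic.leadingCoeff]
      simp
    rw [h1, prod_comp]
    refine Finset.prod_dvd_prod_of_dvd _ _ fun x _ => ?_
    have h2 : (X - C (x ^ q)).comp (X ^ q) = (X - C x) ^ q := by
      rw [hq, sub_pow_char_pow]
      simp
    rw [h2]
    exact pow_dvd_pow _ (((f.roots.count_le_card x).trans hcard).trans hqE)
  refine ⟨s, q, (Multiset.toFinset_card_le _).trans hcard, pow_pos hp.pos _, fun r => ?_⟩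
  have hinj : Function.Injective fun x : F => x ^ q := iterateFrobenius_inj F p E.order
  let v : F → F := fun x => x ^ q
  refine ⟨fun x => aeval S ((Lagrange.basis s v x).comp (X ^ q)) a r, fun n => ?_⟩
  have hlag : ∏ x ∈ s, (X - C (v x)) ∣
      X ^ n - ∑ x ∈ s, C (v x ^ n) * Lagrange.basis s v x := by
    refine Finset.prod_dvd_of_coprime
      (fun x _ y _ hxy => pairwise_coprime_X_sub_C hinj hxy) fun y hy => ?_
    rw [dvd_iff_isRoot, IsRoot.def, eval_sub, eval_finsetSum, Finset.sum_eq_single y]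
    · have h1 : eval (v y) (Lagrange.basis s v y) = 1 := Lagrange.eval_basis_self hinj.injOn hy
      simp [h1]
    · intro x _ hxy
      simp [Lagrange.eval_basis_of_ne hxy hy]
    · exact fun h => absurd hy h
  obtain ⟨g, hg⟩ := hlag
  obtain ⟨g', hg'⟩ := hdvd
  have hzero : aeval S ((X ^ n - ∑ x ∈ s, C (v x ^ n) * Lagrange.basis s v x).comp (X ^ q)) a
      = 0 := by
    rw [hg, mul_comp, hg', mul_assoc, mul_comm, map_mul, Module.End.mul_apply, hfa, map_zero]
  have := congrFun hzero r
  rw [sub_comp, map_sub, LinearMap.sub_apply, Pi.sub_apply, X_pow_comp, ← pow_mul, hS,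
    Pi.zero_apply, sub_eq_zero] at this
  rw [this, Polynomial.sum_comp, map_sum, LinearMap.sum_apply, Finset.sum_apply]
  refine Finset.sum_congr rfl fun x _ => ?_
  rw [mul_comp, C_comp, map_mul, aeval_C, Module.End.mul_apply, Module.algebraMap_end_apply,
    Pi.smul_apply, smul_eq_mul, mul_comm]

end Recurrence

theorem theorem1p3 {K : Type*} [Field K] (p : ℕ) (hp : 0 < p) [CharP K p]
    (a : ℕ → K) (d : ℕ) (ha : IsRecurrenceSeqOfOrder K a d) :
    IsPNormalOfOrderLE p ((d : ℤ) - 2) (zeroSet a) := by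
  classical
  have : Fact p.Prime := ⟨(CharP.char_is_prime_or_zero K p).resolve_right hp.ne'⟩
  obtain ⟨E, rfl, hE⟩ := ha.1
  let F := AlgebraicClosure K
  have : CharP F p := charP_of_injective_algebraMap (algebraMap K F).injective p
  let E' : LinearRecurrence F := ⟨E.order, fun i => algebraMap K F (E.coeffs i)⟩
  have hE' : E'.IsSolution fun n => algebraMap K F (a n) := by
    intro n
    change algebraMap K F (a (n + E.order)) = _
    rw [hE n, map_sum]
    simp [E']
  obtain ⟨s, q, hs, hq, hβ⟩ := exists_exponentialSum_of_isSolution (p := p) E' hE'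
  refine (isAlmostUnion_of_residues hq fun r _ => ?_).isPNormalOfOrderLE
  obtain ⟨β, hβ⟩ := hβ r
  have hcard : (s.filter (· ≠ 0)).card ≤ E.order := (Finset.card_filter_le _ _).trans hs
  refine ((isAlmostUnion_exponentialSum (p := p) (s.filter (· ≠ 0)) β (fun x => x ^ q)
    fun x hx => pow_ne_zero _ (Finset.mem_filter.mp hx).2).mono (by omega)).of_symmDiff ?_
  -- The root `0` only contributes to the term with index `0`.
  refine (Set.finite_singleton 0).subset fun n hn => ?_
  by_contra hn0
  have hn0 : n ≠ 0 := hn0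
  have hiff : n ∈ {k | r + q * k ∈ zeroSet a} ↔
      n ∈ {n : ℕ | ∑ x ∈ s with x ≠ 0, β x * (x ^ q) ^ n = 0} := by
    have h1 : ∑ x ∈ s with x ≠ 0, β x * (x ^ q) ^ n = ∑ x ∈ s, β x * (x ^ q) ^ n := by
      refine Finset.sum_filter_of_ne fun x _ hx h0 => hx ?_
      rw [h0, zero_pow hq.ne', zero_pow hn0, mul_zero]
    rw [Set.mem_ofPred_eq, Set.mem_ofPred_eq, h1, ← hβ, map_eq_zero]
    rfl
  rw [Set.mem_symmDiff, hiff] at hn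
  tauto
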